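/- **Setting.** Let $n,p\ge 0$ be integers, $\sigma>0$, $\theta_0\in\mathbb R^n$, and consider the finite impulse response model $$y(t)=\phi(t)^T\theta_0+v(t),\qquad \phi(t)=[u(t-1),\dots,u(t-n)]^T,\qquad t=1,2,\dots,$$ where $v(1),v(2),\dots$ is zero mean white noise (square integrable, centred, pairwise uncorrelated) with variance $\sigma^2$, and the input $(u(t))_{t\in\mathbb Z}$ is deterministic or, more generally, a random process independent of the noise process. For data length $N$ put $Y=[y(1),\dots,y(N)]^T$, $V=[v(1),\dots,v(N)]^T$ and $\Phi=[\phi(1),\dots,\phi(N)]^T$, so that $Y=\Phi\theta_0+V$. For a positive definite kernel matrix $P\in\mathbb R^{n\times n}$ let $$Q=\Phi P\Phi^T+\sigma^2 I_N,\quad R=\Phi^T\Phi+\sigma^2P^{-1},\quad \widehat\theta^{\rm LS}=(\Phi^T\Phi)^{-1}\Phi^TY,\quad \widehat\theta^{\rm R}(P)=P\Phi^TQ^{-1}Y,$$ and define the criteria $$\mathscr F_{\rm Sg}(P)=\|\widehat\theta^{\rm LS}-\widehat\theta^{\rm R}(P)\|^2+\sigma^2{\rm Tr}\big(2R^{-1}-(\Phi^T\Phi)^{-1}\big),$$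 $$\mathscr F_{\rm Sy}(P)=\|Y-\Phi\widehat\theta^{\rm R}(P)\|^2+2\sigma^2{\rm Tr}(\Phi P\Phi^TQ^{-1}),\qquad \mathscr F_{\rm EB}(P)=Y^TQ^{-1}Y+\log\det Q,$$ with the Oracle counterparts, where $E$ is the expectation over the noise for the given input and $v^*$ is an independent copy of $v$, $${\rm MSEg}(P)=E\|\widehat\theta^{\rm R}(P)-\theta_0\|^2,\quad {\rm MSEy}(P)=E\sum_{t=1}^N\big(\phi(t)^T\theta_0+v^*(t)-\phi(t)^T\widehat\theta^{\rm R}(P)\big)^2,\quad {\rm EEB}(P)=E\,\mathscr F_{\rm EB}(P).$$ Let $\Omega\subset\mathbb R^p$ be nonempty and compact and let $\eta\mapsto P(\eta)$ be any parameterization that is continuous on $\Omega$ with $P(\eta)$ (symmetric) positive definite for every $\eta\in\Omega$. The estimators $\widehat\eta_{\rm Sg},\widehat\eta_{\rm Sy},\widehat\eta_{\rm EB},\widehat\eta_{\rm MSEg},\widehat\eta_{\rm MSEy},\widehat\eta_{\rm EEB}$ (which depend on $N$) are any minimizers over $\eta\in\Omega$ of $\mathscr F_{\rm Sg}(P(\eta))$,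 $\mathscr F_{\rm Sy}(P(\eta))$, $\mathscr F_{\rm EB}(P(\eta))$, ${\rm MSEg}(P(\eta))$, ${\rm MSEy}(P(\eta))$, ${\rm EEB}(P(\eta))$, respectively. For a positive definite $\Sigma\in\mathbb R^{n\times n}$ let $$W_g(P)=\sigma^4\theta_0^TP^{-T}\Sigma^{-2}P^{-1}\theta_0-2\sigma^4{\rm Tr}(\Sigma^{-1}P^{-1}\Sigma^{-1}),$$ $$W_y(P)=\sigma^4\theta_0^TP^{-T}\Sigma^{-1}P^{-1}\theta_0-2\sigma^4{\rm Tr}(\Sigma^{-1}P^{-1}),\qquad W_B(P)=\theta_0^TP^{-1}\theta_0+\log\det P,$$ and let $\eta_g^*,\eta_y^*,\eta_B^*\subset\Omega$ be the sets of all minimizers over $\eta\in\Omega$ of $W_g(P(\eta))$, $W_y(P(\eta))$, $W_B(P(\eta))$, respectively. Convergence $\widehat\eta\to D$ to a set $D$ means that $D\ne\emptyset$ and $\inf_{\bar\eta\in D}\|\widehat\eta-\bar\eta\|\to 0$. **Theorem.** Suppose that $\Phi^T\Phi/N\to\Sigma$ almost surely as $N\to\infty$, where $\Sigma$ is positive definite.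 Then, almost surely, as $N\to\infty$, $$\widehat\eta_{\rm MSEg}\to\eta_g^*,\quad \widehat\eta_{\rm Sg}\to\eta_g^*,\qquad \widehat\eta_{\rm MSEy}\to\eta_y^*,\quad \widehat\eta_{\rm Sy}\to\eta_y^*,\qquad \widehat\eta_{\rm EEB}\to\eta_B^*,\quad \widehat\eta_{\rm EB}\to\eta_B^*.$$ Moreover, every $\eta$ that lies in the interior of $\Omega$ and belongs to $\eta_g^*$, $\eta_y^*$, $\eta_B^*$ satisfies, respectively, for every $i=1,\dots,p$ for which $\partial P(\eta)/\partial\eta_i$ exists, $${\rm Tr}\Big(P(\eta)^{-1}\Sigma^{-2}P(\eta)^{-1}\big(P(\eta)-\theta_0\theta_0^T\big)P(\eta)^{-1}\frac{\partial P(\eta)}{\partial\eta_i}\Big)=0,$$ $${\rm Tr}\Big(P(\eta)^{-1}\Sigma^{-1}P(\eta)^{-1}\big(P(\eta)-\theta_0\theta_0^T\big)P(\eta)^{-1}\frac{\partial P(\eta)}{\partial\eta_i}\Big)=0,$$ $${\rm Tr}\Big(P(\eta)^{-1}\big(P(\eta)-\theta_0\theta_0^T\big)P(\eta)^{-1}\frac{\partial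 P(\eta)}{\partial\eta_i}\Big)=0.$$ -/

import Mathlib

open MeasureTheory ProbabilityTheory Filter Topology Matrix

noncomputable section

namespace KernelReg

/-- Squared Euclidean norm of a coordinate vector. -/
def sqNorm {m : ℕ} (x : Fin m → ℝ) : ℝ := ∑ i, x i ^ 2

/-! ### The model `y(t) = φ(t)ᵀ θ₀ + v(t)`, `t = 1, 2, …` -/

/-- Regressor matrix of data length `N` built from an input sequence `u`: the row with index `i`
belongs to time `t = i + 1` and is `φ(t)ᵀ = [u(t-1), …, u(t-n)]`. -/
def regressor (n N : ℕ) (u : ℤ → ℝ) : Matrix (Fin N) (Fin n) ℝ :=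
  Matrix.of fun i k => u (((i : ℕ) + 1 : ℤ) - ((k : ℕ) + 1 : ℤ))

/-- The noise vector `[v(1), …, v(N)]ᵀ`. -/
def noiseVec (N : ℕ) (v : ℕ+ → ℝ) : Fin N → ℝ := fun i => v (Nat.succPNat i)

/-- The output vector `Y = Φ θ₀ + V`. -/
def output {n N : ℕ} (Φ : Matrix (Fin N) (Fin n) ℝ) (θ₀ : Fin n → ℝ) (V : Fin N → ℝ) :
    Fin N → ℝ := Φ *ᵥ θ₀ + V

/-- Zero mean white noise with variance `σ²`: square integrable, centred, pairwise uncorrelated,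
of constant variance. -/
structure IsWhiteNoise {α : Type*} [MeasurableSpace α] (μ : Measure α) (v : ℕ+ → α → ℝ)
    (σ : ℝ) : Prop where
  memLp : ∀ t, MemLp (v t) 2 μ
  mean_eq_zero : ∀ t, ∫ ω, v t ω ∂μ = 0
  variance_eq : ∀ t, Var[v t; μ] = σ ^ 2
  covariance_eq_zero : ∀ s t, s ≠ t → cov[v s, v t; μ] = 0

/-! ### Least squares and regularized least squares -/

/-- `Q = Φ P Φᵀ + σ² I_N`. -/
def Qmat {n N : ℕ} (σ : ℝ) (Φ : Matrix (Fin N) (Fin n) ℝ) (P : Matrix (Fin n) (Fin n) ℝ) :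
    Matrix (Fin N) (Fin N) ℝ := Φ * P * Φᵀ + σ ^ 2 • 1

/-- `R = Φᵀ Φ + σ² P⁻¹`. -/
def Rmat {n N : ℕ} (σ : ℝ) (Φ : Matrix (Fin N) (Fin n) ℝ) (P : Matrix (Fin n) (Fin n) ℝ) :
    Matrix (Fin n) (Fin n) ℝ := Φᵀ * Φ + σ ^ 2 • P⁻¹

/-- The least squares estimate `(Φᵀ Φ)⁻¹ Φᵀ Y`. -/
def thetaLS {n N : ℕ} (Φ : Matrix (Fin N) (Fin n) ℝ) (Y : Fin N → ℝ) : Fin n → ℝ :=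
  ((Φᵀ * Φ)⁻¹ * Φᵀ) *ᵥ Y

/-- The regularized least squares estimate `P Φᵀ Q⁻¹ Y`. -/
def thetaR {n N : ℕ} (σ : ℝ) (Φ : Matrix (Fin N) (Fin n) ℝ) (Y : Fin N → ℝ)
    (P : Matrix (Fin n) (Fin n) ℝ) : Fin n → ℝ :=
  (P * Φᵀ * (Qmat σ Φ P)⁻¹) *ᵥ Y

/-! ### Data-based criteria -/

/-- The SUREg criterion. -/
def FSg {n N : ℕ} (σ : ℝ) (Φ : Matrix (Fin N) (Fin n) ℝ) (Y : Fin N → ℝ)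
    (P : Matrix (Fin n) (Fin n) ℝ) : ℝ :=
  sqNorm (thetaLS Φ Y - thetaR σ Φ Y P)
    + σ ^ 2 * ((2 : ℝ) • (Rmat σ Φ P)⁻¹ - (Φᵀ * Φ)⁻¹).trace

/-- The SUREy criterion. -/
def FSy {n N : ℕ} (σ : ℝ) (Φ : Matrix (Fin N) (Fin n) ℝ) (Y : Fin N → ℝ)
    (P : Matrix (Fin n) (Fin n) ℝ) : ℝ :=
  sqNorm (Y - Φ *ᵥ thetaR σ Φ Y P) + 2 * σ ^ 2 * (Φ * P * Φᵀ * (Qmat σ Φ P)⁻¹).trace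

/-- The empirical Bayes criterion `Yᵀ Q⁻¹ Y + log det Q`. -/
def FEB {n N : ℕ} (σ : ℝ) (Φ : Matrix (Fin N) (Fin n) ℝ) (Y : Fin N → ℝ)
    (P : Matrix (Fin n) (Fin n) ℝ) : ℝ :=
  Y ⬝ᵥ ((Qmat σ Φ P)⁻¹ *ᵥ Y) + Real.log (Qmat σ Φ P).det

/-! ### Oracle criteria

The expectations are over the noise, for a given regressor matrix `Φ`. -/

section Oracle

variable {α : Type*} [MeasurableSpace α]

/-- `MSEg(P) = E ‖θ̂ᴿ(P) - θ₀‖²`. -/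
def MSEg {n N : ℕ} (μ : Measure α) (v : ℕ+ → α → ℝ) (σ : ℝ) (θ₀ : Fin n → ℝ)
    (Φ : Matrix (Fin N) (Fin n) ℝ) (P : Matrix (Fin n) (Fin n) ℝ) : ℝ :=
  ∫ ω, sqNorm (thetaR σ Φ (output Φ θ₀ (noiseVec N fun t => v t ω)) P - θ₀) ∂μ

/-- `MSEy(P) = E ∑ₜ (φ(t)ᵀ θ₀ + v*(t) - φ(t)ᵀ θ̂ᴿ(P))²`, where `v*` is an independent copy of the
noise, realized as the second coordinate of the product space. -/
def MSEy {n N : ℕ} (μ : Measure α) (v : ℕ+ → α → ℝ) (σ : ℝ) (θ₀ : Fin n → ℝ)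
    (Φ : Matrix (Fin N) (Fin n) ℝ) (P : Matrix (Fin n) (Fin n) ℝ) : ℝ :=
  ∫ z : α × α, sqNorm (output Φ θ₀ (noiseVec N fun t => v t z.2)
    - Φ *ᵥ thetaR σ Φ (output Φ θ₀ (noiseVec N fun t => v t z.1)) P) ∂(μ.prod μ)

/-- `EEB(P) = E F_EB(P)`. -/
def EEB {n N : ℕ} (μ : Measure α) (v : ℕ+ → α → ℝ) (σ : ℝ) (θ₀ : Fin n → ℝ)
    (Φ : Matrix (Fin N) (Fin n) ℝ) (P : Matrix (Fin n) (Fin n) ℝ) : ℝ :=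
  ∫ ω, FEB σ Φ (output Φ θ₀ (noiseVec N fun t => v t ω)) P ∂μ

end Oracle

/-! ### Limit criteria -/

/-- `W_g = σ⁴ θ₀ᵀ P⁻ᵀ Σ⁻² P⁻¹ θ₀ - 2 σ⁴ Tr (Σ⁻¹ P⁻¹ Σ⁻¹)`. -/
def Wg {n : ℕ} (σ : ℝ) (P S : Matrix (Fin n) (Fin n) ℝ) (θ₀ : Fin n → ℝ) : ℝ :=
  σ ^ 4 * (θ₀ ⬝ᵥ ((P⁻¹ᵀ * S⁻¹ * S⁻¹ * P⁻¹) *ᵥ θ₀)) - 2 * σ ^ 4 * (S⁻¹ * P⁻¹ * S⁻¹).trace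

/-- `W_y = σ⁴ θ₀ᵀ P⁻ᵀ Σ⁻¹ P⁻¹ θ₀ - 2 σ⁴ Tr (Σ⁻¹ P⁻¹)`. -/
def Wy {n : ℕ} (σ : ℝ) (P S : Matrix (Fin n) (Fin n) ℝ) (θ₀ : Fin n → ℝ) : ℝ :=
  σ ^ 4 * (θ₀ ⬝ᵥ ((P⁻¹ᵀ * S⁻¹ * P⁻¹) *ᵥ θ₀)) - 2 * σ ^ 4 * (S⁻¹ * P⁻¹).trace

/-- `W_B = θ₀ᵀ P⁻¹ θ₀ + log det P`. -/
def WB {n : ℕ} (P : Matrix (Fin n) (Fin n) ℝ) (θ₀ : Fin n → ℝ) : ℝ :=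
  θ₀ ⬝ᵥ (P⁻¹ *ᵥ θ₀) + Real.log P.det

/-! ### Minimizers and their convergence -/

/-- The set of minimizing arguments of `M` over `Ω`. -/
def argminSet {E : Type*} (M : E → ℝ) (Ω : Set E) : Set E := {η | η ∈ Ω ∧ IsMinOn M Ω η}

/-- Minimizers of `M N` over `Ω` converge to the (nonempty) set `D`: whatever minimizers `η̂ N` are
selected, `inf_{d ∈ D} ‖η̂ N - d‖ → 0`. -/
def MinimizersTendsto {E : Type*} [PseudoMetricSpace E] (M : ℕ → E → ℝ) (Ω D : Set E) : Prop :=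
  D.Nonempty ∧ ∀ ηhat : ℕ → E, (∀ᶠ N in atTop, ηhat N ∈ argminSet (M N) Ω) →
    Tendsto (fun N => Metric.infDist (ηhat N) D) atTop (𝓝 0)

/-- `D` is the matrix of partial derivatives `∂P(η)/∂η_i` at `η` (entrywise). -/
def HasPartialDeriv {n p : ℕ} (P : EuclideanSpace ℝ (Fin p) → Matrix (Fin n) (Fin n) ℝ)
    (D : Matrix (Fin n) (Fin n) ℝ) (η : EuclideanSpace ℝ (Fin p)) (i : Fin p) : Prop :=
  ∀ k l, HasLineDerivAt ℝ (fun η' => P η' k l) (D k l) η (EuclideanSpace.single i 1)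

end KernelReg

end

/-! Write `G = Φᵀ * Φ`. Since `R = G + σ² P⁻¹`, one has `R⁻¹ G = 1 - σ² R⁻¹ P⁻¹`. This identity
strips from every criterion a leading part that does not depend on `η`; what remains has order `N⁻²`
(SUREg, MSEg), `N⁻¹` (SUREy, MSEy) or `1` (EB, EEB). Such affine changes do not move minimizers.
After rescaling, the remainder is an explicit function of `(R / N)⁻¹`, `G / N`, `P⁻¹` and, for the
data-based criteria, of the least squares estimate; in the oracle criteria `θ₀` takes its place,
together with trace terms.

Because `σ² P⁻¹ / N` vanishes, `(R / N)⁻¹` tends to `S⁻¹` jointly in `N` and `η`. The rescaled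
criteria therefore converge continuously on the compact `Ω` to `Wg`, `Wy` and `WB`, and
`minimizersTendsto_of_tendsto` turns this into convergence of minimizers.

The only probabilistic limit is strong consistency of least squares, `ae_tendsto_thetaLS`, that is,
`Φᵀ V / N → 0`. The noise is merely uncorrelated and the regressors are bounded only in mean square,
so the strong law is proved directly: second moments control the times `N = m²`, Cauchy–Schwarz
controls the gaps between them, and Abel summation gives summability. A random input is frozen by
independence and Fubini.

The stationarity equations are Fermat's rule along coordinate lines, with the derivatives of the
inverse and of the determinant computed from entrywise derivatives. -/

noncomputable section

namespace KernelReg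

/-! ### Exact algebraic decompositions of the data-based criteria. -/

section Algebra

variable {n N : ℕ} {σ : ℝ} {Φ : Matrix (Fin N) (Fin n) ℝ} {P : Matrix (Fin n) (Fin n) ℝ}

lemma sqNorm_eq_dotProduct {m : ℕ} (x : Fin m → ℝ) : sqNorm x = x ⬝ᵥ x := by
  simp [sqNorm, dotProduct, sq]

lemma posDef_sq_smul {m : ℕ} (hσ : 0 < σ) {A : Matrix (Fin m) (Fin m) ℝ} (hA : A.PosDef) :
    (σ ^ 2 • A).PosDef :=
  hA.smul (by positivity)

lemma posDef_Qmat (hσ : 0 < σ) (hP : P.PosDef) : (Qmat σ Φ P).PosDef := by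
  have h := hP.posSemidef.mul_mul_conjTranspose_same Φ
  rw [conjTranspose_eq_transpose_of_trivial] at h
  exact PosDef.posSemidef_add h (posDef_sq_smul hσ PosDef.one)

lemma posDef_Rmat (hσ : 0 < σ) (hP : P.PosDef) : (Rmat σ Φ P).PosDef := by
  have h := posSemidef_conjTranspose_mul_self Φ
  rw [conjTranspose_eq_transpose_of_trivial] at h
  exact PosDef.posSemidef_add h (posDef_sq_smul hσ hP.inv)

lemma isUnit_det_of_posDef {m : ℕ} {A : Matrix (Fin m) (Fin m) ℝ} (hA : A.PosDef) :
    IsUnit A.det := hA.det_pos.ne'.isUnit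

lemma transpose_eq_of_posDef {m : ℕ} {A : Matrix (Fin m) (Fin m) ℝ} (hA : A.PosDef) :
    Aᵀ = A := by
  have h := hA.isHermitian.eq
  rwa [conjTranspose_eq_transpose_of_trivial] at h

/-- Push-through identity: `R P Φᵀ` and `Φᵀ Q` both equal `Φᵀ Φ P Φᵀ + σ² Φᵀ`. It trades the growing
`N × N` inverse for one of fixed size `n`. -/
lemma gain_eq (hσ : 0 < σ) (hP : P.PosDef) :
    P * Φᵀ * (Qmat σ Φ P)⁻¹ = (Rmat σ Φ P)⁻¹ * Φᵀ := by
  have hQ := isUnit_det_of_posDef (posDef_Qmat (Φ := Φ) hσ hP)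
  have hR := isUnit_det_of_posDef (posDef_Rmat (Φ := Φ) hσ hP)
  have h : Rmat σ Φ P * (P * Φᵀ) = Φᵀ * Qmat σ Φ P := by
    have hPi := nonsing_inv_mul P (isUnit_det_of_posDef hP)
    simp only [Rmat, Qmat, Matrix.add_mul, Matrix.mul_add, Matrix.smul_mul, Matrix.mul_smul,
      Matrix.mul_one, Matrix.one_mul, ← Matrix.mul_assoc, hPi]
  calc P * Φᵀ * (Qmat σ Φ P)⁻¹
      = (Rmat σ Φ P)⁻¹ * (Rmat σ Φ P * (P * Φᵀ)) * (Qmat σ Φ P)⁻¹ := by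
        rw [nonsing_inv_mul_cancel_left _ _ hR]
    _ = (Rmat σ Φ P)⁻¹ * Φᵀ := by
        rw [h, ← Matrix.mul_assoc, mul_nonsing_inv_cancel_right _ _ hQ]

lemma thetaR_eq (hσ : 0 < σ) (hP : P.PosDef) (Y : Fin N → ℝ) :
    thetaR σ Φ Y P = (Rmat σ Φ P)⁻¹ *ᵥ (Φᵀ *ᵥ Y) := by
  rw [thetaR, gain_eq hσ hP, mulVec_mulVec]

lemma Qmat_inv (hσ : 0 < σ) (hP : P.PosDef) :
    (Qmat σ Φ P)⁻¹ = (σ ^ 2)⁻¹ • (1 - Φ * (Rmat σ Φ P)⁻¹ * Φᵀ) := by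
  have hQ := isUnit_det_of_posDef (posDef_Qmat (Φ := Φ) hσ hP)
  have h1 : Φ * (Rmat σ Φ P)⁻¹ * Φᵀ = 1 - σ ^ 2 • (Qmat σ Φ P)⁻¹ := by
    rw [Matrix.mul_assoc, ← gain_eq hσ hP, eq_sub_iff_add_eq]
    have := mul_nonsing_inv _ hQ
    conv_lhs at this => enter [1]; rw [Qmat]
    rw [add_mul, smul_mul_assoc, one_mul] at this
    rw [← this]
    simp only [Matrix.mul_assoc]
  rw [h1, sub_sub_cancel, smul_smul, inv_mul_cancel₀ (by positivity), one_smul]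

lemma Rmat_inv_mul_gram (hσ : 0 < σ) (hP : P.PosDef) :
    (Rmat σ Φ P)⁻¹ * (Φᵀ * Φ) = 1 - σ ^ 2 • ((Rmat σ Φ P)⁻¹ * P⁻¹) := by
  have hR := isUnit_det_of_posDef (posDef_Rmat (Φ := Φ) hσ hP)
  have h := nonsing_inv_mul _ hR
  conv_lhs at h => enter [2]; rw [Rmat]
  rw [mul_add, mul_smul_comm] at h
  rw [← h, add_sub_cancel_right]

lemma gram_mul_Rmat_inv (hσ : 0 < σ) (hP : P.PosDef) :
    (Φᵀ * Φ) * (Rmat σ Φ P)⁻¹ = 1 - σ ^ 2 • (P⁻¹ * (Rmat σ Φ P)⁻¹) := by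
  have hR := isUnit_det_of_posDef (posDef_Rmat (Φ := Φ) hσ hP)
  have h := mul_nonsing_inv _ hR
  conv_lhs at h => enter [1]; rw [Rmat]
  rw [add_mul, smul_mul_assoc] at h
  rw [← h, add_sub_cancel_right]

lemma Rmat_inv_eq (hσ : 0 < σ) (hP : P.PosDef) (hG : IsUnit (Φᵀ * Φ).det) :
    (Rmat σ Φ P)⁻¹ = (Φᵀ * Φ)⁻¹ - σ ^ 2 • ((Rmat σ Φ P)⁻¹ * P⁻¹ * (Φᵀ * Φ)⁻¹) := by
  have h := congrArg (· * (Φᵀ * Φ)⁻¹) (Rmat_inv_mul_gram (Φ := Φ) hσ hP)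
  simpa only [mul_nonsing_inv_cancel_right _ _ hG, sub_mul, one_mul, smul_mul_assoc] using h

lemma gram_mul_Rmat_inv_mul_gram (hσ : 0 < σ) (hP : P.PosDef) :
    (Φᵀ * Φ) * (Rmat σ Φ P)⁻¹ * (Φᵀ * Φ)
      = Φᵀ * Φ - σ ^ 2 • P⁻¹ + σ ^ 4 • (P⁻¹ * (Rmat σ Φ P)⁻¹ * P⁻¹) := by
  rw [gram_mul_Rmat_inv hσ hP, sub_mul, one_mul, smul_mul_assoc, Matrix.mul_assoc,
    Rmat_inv_mul_gram hσ hP, mul_sub, mul_one, mul_smul_comm, smul_sub, smul_smul,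
    ← Matrix.mul_assoc]
  rw [show σ ^ 4 = σ ^ 2 * σ ^ 2 by ring]
  abel

/-- Sylvester's identity `det (1 + A B) = det (1 + B A)` reduces the determinant to size `n`. The
power of `σ²` is kept as a product because `N < n` is allowed. -/
lemma log_det_Qmat (hσ : 0 < σ) (hP : P.PosDef) :
    Real.log (Qmat σ Φ P).det
      = Real.log ((σ ^ 2) ^ N * ((σ ^ 2)⁻¹) ^ n) + Real.log P.det
        + Real.log (Rmat σ Φ P).det := by
  have hs : σ ^ 2 ≠ 0 := by positivity
  have h1 : Qmat σ Φ P = σ ^ 2 • (1 + Φ * ((σ ^ 2)⁻¹ • (P * Φᵀ))) := by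
    rw [Qmat, Matrix.mul_smul, smul_add, smul_smul, mul_inv_cancel₀ hs, one_smul, Matrix.mul_assoc,
      add_comm]
  have h2 : (1 : Matrix (Fin n) (Fin n) ℝ) + ((σ ^ 2)⁻¹ • (P * Φᵀ)) * Φ
      = (σ ^ 2)⁻¹ • (P * Rmat σ Φ P) := by
    rw [Rmat, mul_add, mul_smul_comm, mul_nonsing_inv _ (isUnit_det_of_posDef hP), smul_add,
      smul_smul, inv_mul_cancel₀ hs, one_smul, Matrix.smul_mul, Matrix.mul_assoc, add_comm]
  have h3 : (Qmat σ Φ P).det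
      = ((σ ^ 2) ^ N * ((σ ^ 2)⁻¹) ^ n) * P.det * (Rmat σ Φ P).det := by
    rw [h1, det_smul, det_one_add_mul_comm, h2, det_smul, det_mul]
    simp only [Fintype.card_fin]
    ring
  have hR := (posDef_Rmat (Φ := Φ) hσ hP).det_pos.ne'
  have hc : (σ ^ 2) ^ N * ((σ ^ 2)⁻¹) ^ n ≠ 0 := by positivity
  rw [h3, Real.log_mul (mul_ne_zero hc hP.det_pos.ne') hR, Real.log_mul hc hP.det_pos.ne']

lemma transpose_mulVec_eq_gram_mulVec (hG : IsUnit (Φᵀ * Φ).det) (Y : Fin N → ℝ) :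
    Φᵀ *ᵥ Y = (Φᵀ * Φ) *ᵥ thetaLS Φ Y := by
  rw [thetaLS, mulVec_mulVec, mul_nonsing_inv_cancel_left _ _ hG]

lemma sub_Rmat_inv_mulVec_gram (hσ : 0 < σ) (hP : P.PosDef) (θ : Fin n → ℝ) :
    θ - (Rmat σ Φ P)⁻¹ *ᵥ ((Φᵀ * Φ) *ᵥ θ) = σ ^ 2 • ((Rmat σ Φ P)⁻¹ *ᵥ (P⁻¹ *ᵥ θ)) := by
  rw [mulVec_mulVec, Rmat_inv_mul_gram hσ hP, sub_mulVec, one_mulVec, smul_mulVec, mulVec_mulVec]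
  abel

lemma thetaLS_sub_thetaR (hσ : 0 < σ) (hP : P.PosDef) (hG : IsUnit (Φᵀ * Φ).det)
    (Y : Fin N → ℝ) :
    thetaLS Φ Y - thetaR σ Φ Y P
      = σ ^ 2 • ((Rmat σ Φ P)⁻¹ *ᵥ (P⁻¹ *ᵥ thetaLS Φ Y)) := by
  rw [thetaR_eq hσ hP, transpose_mulVec_eq_gram_mulVec hG, sub_Rmat_inv_mulVec_gram hσ hP]

lemma sqNorm_smul {m : ℕ} (c : ℝ) (x : Fin m → ℝ) : sqNorm (c • x) = c ^ 2 * sqNorm x := by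
  simp [sqNorm, mul_pow, Finset.mul_sum]

lemma sqNorm_mulVec (Φ : Matrix (Fin N) (Fin n) ℝ) (x : Fin n → ℝ) :
    sqNorm (Φ *ᵥ x) = x ⬝ᵥ ((Φᵀ * Φ) *ᵥ x) := by
  rw [sqNorm_eq_dotProduct, ← mulVec_mulVec, dotProduct_mulVec x, vecMul_transpose]

/-- Expanding `R⁻¹` around `(Φᵀ Φ)⁻¹` isolates a first term free of `P`; each remaining term carries
two inverses of order `N⁻¹`. -/
lemma FSg_eq (hσ : 0 < σ) (hP : P.PosDef) (hG : IsUnit (Φᵀ * Φ).det) (Y : Fin N → ℝ) :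
    FSg σ Φ Y P = σ ^ 2 * ((Φᵀ * Φ)⁻¹).trace
      + (σ ^ 4 * sqNorm ((Rmat σ Φ P)⁻¹ *ᵥ (P⁻¹ *ᵥ thetaLS Φ Y))
        - 2 * σ ^ 4 * ((Rmat σ Φ P)⁻¹ * P⁻¹ * (Φᵀ * Φ)⁻¹).trace) := by
  rw [FSg, thetaLS_sub_thetaR hσ hP hG, sqNorm_smul, trace_sub, trace_smul]
  conv_lhs => enter [2, 2, 1]; rw [Rmat_inv_eq hσ hP hG]
  rw [trace_sub, trace_smul]
  simp only [smul_eq_mul]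
  ring

lemma trace_fit (hσ : 0 < σ) (hP : P.PosDef) :
    (Φ * P * Φᵀ * (Qmat σ Φ P)⁻¹).trace = n - σ ^ 2 * ((Rmat σ Φ P)⁻¹ * P⁻¹).trace := by
  rw [Matrix.mul_assoc Φ, Matrix.mul_assoc Φ, gain_eq hσ hP, trace_mul_comm, Matrix.mul_assoc,
    Rmat_inv_mul_gram hσ hP, trace_sub, trace_smul]
  simp

lemma FSy_eq (hσ : 0 < σ) (hP : P.PosDef) (hG : IsUnit (Φᵀ * Φ).det) (Y : Fin N → ℝ) :
    FSy σ Φ Y P = (sqNorm (Y - Φ *ᵥ thetaLS Φ Y) + 2 * σ ^ 2 * n)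
      + (σ ^ 4 * (((Rmat σ Φ P)⁻¹ *ᵥ (P⁻¹ *ᵥ thetaLS Φ Y))
          ⬝ᵥ ((Φᵀ * Φ) *ᵥ ((Rmat σ Φ P)⁻¹ *ᵥ (P⁻¹ *ᵥ thetaLS Φ Y))))
        - 2 * σ ^ 4 * ((Rmat σ Φ P)⁻¹ * P⁻¹).trace) := by
  have h1 : Y - Φ *ᵥ thetaR σ Φ Y P
      = (Y - Φ *ᵥ thetaLS Φ Y) + Φ *ᵥ (thetaLS Φ Y - thetaR σ Φ Y P) := by
    rw [mulVec_sub]; abel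
  -- Normal equations: the least squares residual is orthogonal to the range of `Φ`, so the fit
  -- error splits by Pythagoras.
  have h2 : ∀ x, (Y - Φ *ᵥ thetaLS Φ Y) ⬝ᵥ (Φ *ᵥ x) = 0 := by
    intro x
    rw [dotProduct_mulVec, ← mulVec_transpose, mulVec_sub, transpose_mulVec_eq_gram_mulVec hG,
      mulVec_mulVec, sub_self, zero_dotProduct]
  have h3 : sqNorm (Y - Φ *ᵥ thetaR σ Φ Y P) = sqNorm (Y - Φ *ᵥ thetaLS Φ Y)
      + sqNorm (Φ *ᵥ (thetaLS Φ Y - thetaR σ Φ Y P)) := by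
    rw [h1]
    simp only [sqNorm_eq_dotProduct, add_dotProduct, dotProduct_add, h2,
      dotProduct_comm (Φ *ᵥ _) (Y - _)]
    ring
  rw [FSy, h3, trace_fit hσ hP, thetaLS_sub_thetaR hσ hP hG, mulVec_smul, sqNorm_smul,
    sqNorm_mulVec]
  ring

lemma FEB_eq (hσ : 0 < σ) (hP : P.PosDef) (hG : IsUnit (Φᵀ * Φ).det) (Y : Fin N → ℝ) :
    FEB σ Φ Y P = ((σ ^ 2)⁻¹ * (Y ⬝ᵥ Y - thetaLS Φ Y ⬝ᵥ ((Φᵀ * Φ) *ᵥ thetaLS Φ Y))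
        + Real.log ((σ ^ 2) ^ N * ((σ ^ 2)⁻¹) ^ n))
      + (thetaLS Φ Y ⬝ᵥ (P⁻¹ *ᵥ thetaLS Φ Y)
        - σ ^ 2 * (thetaLS Φ Y ⬝ᵥ ((P⁻¹ * (Rmat σ Φ P)⁻¹ * P⁻¹) *ᵥ thetaLS Φ Y))
        + Real.log P.det + Real.log (Rmat σ Φ P).det) := by
  have hs : σ ^ 2 ≠ 0 := by positivity
  have h1 : Y ⬝ᵥ ((Φ * (Rmat σ Φ P)⁻¹ * Φᵀ) *ᵥ Y)
      = thetaLS Φ Y ⬝ᵥ (((Φᵀ * Φ) * (Rmat σ Φ P)⁻¹ * (Φᵀ * Φ)) *ᵥ thetaLS Φ Y) := by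
    have hGs : (Φᵀ * Φ)ᵀ = Φᵀ * Φ := by rw [transpose_mul, transpose_transpose]
    rw [← mulVec_mulVec, ← mulVec_mulVec, dotProduct_mulVec Y, ← mulVec_transpose Φ Y,
      transpose_mulVec_eq_gram_mulVec hG]
    generalize Φᵀ * Φ = G at hGs ⊢
    rw [← mulVec_mulVec, ← mulVec_mulVec, dotProduct_mulVec (thetaLS Φ Y) G,
      ← mulVec_transpose G, hGs]
  rw [FEB, log_det_Qmat hσ hP, Qmat_inv hσ hP, smul_mulVec, dotProduct_smul, sub_mulVec,
    one_mulVec, dotProduct_sub, h1, gram_mul_Rmat_inv_mul_gram hσ hP, add_mulVec, sub_mulVec,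
    smul_mulVec, smul_mulVec, dotProduct_add, dotProduct_sub, dotProduct_smul, dotProduct_smul]
  simp only [smul_eq_mul]
  field_simp
  ring

end Algebra

/-! ### Convergence of minimizers on a compact set. -/

section Argmin

variable {E : Type*} [PseudoMetricSpace E] {Ω : Set E}

lemma argminSet_nonempty (hΩ : IsCompact Ω) (hne : Ω.Nonempty) {W : E → ℝ}
    (hW : ContinuousOn W Ω) : (argminSet W Ω).Nonempty := by
  obtain ⟨x, hx, hmin⟩ := hΩ.exists_isMinOn hne hW
  exact ⟨x, hx, hmin⟩

/-- Finitely many of the local neighbourhoods cover `K`, so finitely many eventual conditions on `i`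
suffice. -/
lemma eventually_forall_of_isCompact {ι : Type*} {l : Filter ι} {K : Set E}
    (hK : IsCompact K) {p : ι × E → Prop} (h : ∀ η ∈ K, ∀ᶠ z in l ×ˢ 𝓝[K] η, p z) :
    ∀ᶠ i in l, ∀ η ∈ K, p (i, η) := by
  refine hK.induction_on (p := fun s => ∀ᶠ i in l, ∀ η ∈ s, p (i, η)) (by simp) ?_ ?_ ?_
  · exact fun s t hst ht => ht.mono fun i hi η hη => hi η (hst hη)
  · intro s t hs ht
    filter_upwards [hs, ht] with i h1 h2 η hη
    exact hη.elim (h1 η) (h2 η)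
  · intro η hη
    obtain ⟨pa, hpa, pb, hpb, hab⟩ := eventually_prod_iff.1 (h η hη)
    exact ⟨{x | pb x}, hpb, hpa.mono fun i hi x hx => hab hi hx⟩

/-- If, up to affine changes depending only on `N`, the criteria `M N` converge continuously on the
compact set `Ω` to `W`, then their minimizers converge to the set of minimizers of `W`. -/
lemma minimizersTendsto_of_tendsto (hΩ : IsCompact Ω) (hne : Ω.Nonempty)
    {M F : ℕ → E → ℝ} {W : E → ℝ} (a b : ℕ → ℝ) (hb : ∀ᶠ N in atTop, 0 < b N)
    (hM : ∀ᶠ N in atTop, ∀ η ∈ Ω, M N η = a N + b N * F N η)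
    (hW : ContinuousOn W Ω)
    (hF : ∀ η ∈ Ω, Tendsto (fun z : ℕ × E => F z.1 z.2) (atTop ×ˢ 𝓝[Ω] η) (𝓝 (W η))) :
    MinimizersTendsto M Ω (argminSet W Ω) := by
  obtain ⟨d, hd⟩ := argminSet_nonempty hΩ hne hW
  refine ⟨⟨d, hd⟩, fun ηhat hη => ?_⟩
  refine Metric.tendsto_nhds.2 fun ε hε => ?_
  -- The bad set, compact. Eventually `F N` exceeds its value at the fixed minimizer `d` of `W`
  -- everywhere on it, so no minimizer of `M N` can lie there.
  set K : Set E := Ω ∩ {η | ε ≤ Metric.infDist η (argminSet W Ω)} with hK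
  have hKc : IsCompact K :=
    hΩ.inter_right (isClosed_le continuous_const (Metric.continuous_infDist_pt _))
  have hdlim : Tendsto (fun N => F N d) atTop (𝓝 (W d)) :=
    (hF d hd.1).comp (tendsto_id.prodMk
      (tendsto_const_nhdsWithin hd.1))
  have hev : ∀ᶠ N in atTop, ∀ η ∈ K, F N d < F N η := by
    refine eventually_forall_of_isCompact (p := fun z : ℕ × E => F z.1 d < F z.1 z.2) hKc ?_
    intro η hηK
    have hlt : W d < W η := by
      by_contra! hle
      have hmem : η ∈ argminSet W Ω := ⟨hηK.1, fun x hx => hle.trans (hd.2 hx)⟩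
      have := hηK.2
      simp only [Set.mem_ofPred_eq, Metric.infDist_zero_of_mem hmem] at this
      linarith
    have h1 := (hF η hηK.1).mono_left
      (Filter.prod_mono_right atTop (nhdsWithin_mono η (Set.inter_subset_left : K ⊆ Ω)))
    exact (hdlim.comp tendsto_fst).eventually_lt h1 hlt
  filter_upwards [hev, hη, hb, hM] with N h1 h2 h3 h4
  rw [Real.dist_0_eq_abs, abs_of_nonneg Metric.infDist_nonneg]
  by_contra! hle
  have h5 := h1 _ ⟨h2.1, hle⟩
  have h6 : M N (ηhat N) ≤ M N d := h2.2 hd.1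
  rw [h4 _ h2.1, h4 _ hd.1] at h6
  have := mul_lt_mul_of_pos_left h5 h3
  linarith

end Argmin

/-! ### Continuity of matrix operations along filters. -/

section Limits

variable {ι : Type*} {l : Filter ι} {m : ℕ}

lemma tendsto_matrix_inv {f : ι → Matrix (Fin m) (Fin m) ℝ} {A : Matrix (Fin m) (Fin m) ℝ}
    (hf : Tendsto f l (𝓝 A)) (hA : A.det ≠ 0) : Tendsto (fun i => (f i)⁻¹) l (𝓝 A⁻¹) := by
  have h1 : Tendsto (fun i => (f i).det) l (𝓝 A.det) :=
    ((continuous_id.matrix_det).tendsto A).comp hf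
  have h2 : Tendsto (fun i => (f i).adjugate) l (𝓝 A.adjugate) :=
    ((continuous_id.matrix_adjugate).tendsto A).comp hf
  simp only [Matrix.inv_def, Ring.inverse_eq_inv']
  exact (h1.inv₀ hA).smul h2

lemma tendsto_matrix_log_det {f : ι → Matrix (Fin m) (Fin m) ℝ} {A : Matrix (Fin m) (Fin m) ℝ}
    (hf : Tendsto f l (𝓝 A)) (hA : A.det ≠ 0) :
    Tendsto (fun i => Real.log (f i).det) l (𝓝 (Real.log A.det)) :=
  (((continuous_id.matrix_det).tendsto A).comp hf).log hA

lemma tendsto_matrix_trace {f : ι → Matrix (Fin m) (Fin m) ℝ} {A : Matrix (Fin m) (Fin m) ℝ}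
    (hf : Tendsto f l (𝓝 A)) : Tendsto (fun i => (f i).trace) l (𝓝 A.trace) :=
  ((continuous_id.matrix_trace).tendsto A).comp hf

lemma tendsto_mulVec {f : ι → Matrix (Fin m) (Fin m) ℝ} {A : Matrix (Fin m) (Fin m) ℝ}
    {g : ι → Fin m → ℝ} {x : Fin m → ℝ} (hf : Tendsto f l (𝓝 A)) (hg : Tendsto g l (𝓝 x)) :
    Tendsto (fun i => f i *ᵥ g i) l (𝓝 (A *ᵥ x)) :=
  ((continuous_fst.matrix_mulVec continuous_snd).tendsto (A, x)).comp (hf.prodMk_nhds hg)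

lemma tendsto_dotProduct {f g : ι → Fin m → ℝ} {x y : Fin m → ℝ}
    (hf : Tendsto f l (𝓝 x)) (hg : Tendsto g l (𝓝 y)) :
    Tendsto (fun i => f i ⬝ᵥ g i) l (𝓝 (x ⬝ᵥ y)) :=
  ((continuous_fst.dotProduct continuous_snd).tendsto (x, y)).comp (hf.prodMk_nhds hg)

end Limits

/-! ### Second moments of affine and quadratic functions of white noise. -/

section Moments

variable {α : Type*} [MeasurableSpace α] {μ : Measure α}

/-- Square integrable, centred, orthogonal random variables of common second moment `s`. -/
structure IsWhite {ι : Type*} [DecidableEq ι] (μ : Measure α) (w : ι → α → ℝ) (s : ℝ) :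
    Prop where
  memLp : ∀ i, MemLp (w i) 2 μ
  mean : ∀ i, ∫ ω, w i ω ∂μ = 0
  moment : ∀ i j, ∫ ω, w i ω * w j ω ∂μ = if i = j then s else 0

lemma IsWhiteNoise.isWhite [IsProbabilityMeasure μ] {v : ℕ+ → α → ℝ} {σ : ℝ}
    (hv : IsWhiteNoise μ v σ) : IsWhite μ v (σ ^ 2) where
  memLp := hv.memLp
  mean := hv.mean_eq_zero
  moment i j := by
    have h := covariance_eq_sub (hv.memLp i) (hv.memLp j)
    rw [hv.mean_eq_zero i, zero_mul, sub_zero] at h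
    have h' : ∫ ω, v i ω * v j ω ∂μ = cov[v i, v j; μ] := h.symm
    rw [h']
    split_ifs with hij
    · subst hij
      rw [covariance_self (hv.memLp i).aestronglyMeasurable.aemeasurable, hv.variance_eq]
    · exact hv.covariance_eq_zero i j hij

lemma IsWhite.comp_injective {ι κ : Type*} [DecidableEq ι] [DecidableEq κ] {w : ι → α → ℝ}
    {s : ℝ} (hw : IsWhite μ w s) {e : κ → ι} (he : Function.Injective e) :
    IsWhite μ (fun k => w (e k)) s where
  memLp k := hw.memLp _
  mean k := hw.mean _
  moment i j := by simp [hw.moment, he.eq_iff]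

section Quadratic

lemma IsWhite.integrable_mul {ι : Type*} [DecidableEq ι] {w : ι → α → ℝ} {s : ℝ}
    (hw : IsWhite μ w s) (i j : ι) : Integrable (fun ω => w i ω * w j ω) μ :=
  (hw.memLp i).integrable_mul (hw.memLp j)

variable {ι : Type*} [Fintype ι] [DecidableEq ι] {w : ι → α → ℝ} {s : ℝ}

variable [IsProbabilityMeasure μ]

lemma IsWhite.memLp_affine (hw : IsWhite μ w s) (c : ℝ) (b : ι → ℝ) :
    MemLp (fun ω => c + b ⬝ᵥ fun i => w i ω) 2 μ := by
  have h : MemLp (fun ω => ∑ i, b i * w i ω) 2 μ :=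
    memLp_finsetSum _ fun i _ => (hw.memLp i).const_mul (b i)
  exact (memLp_const c).add h

lemma IsWhite.integral_affine_mul (hw : IsWhite μ w s) (c c' : ℝ) (b b' : ι → ℝ) :
    ∫ ω, (c + b ⬝ᵥ fun i => w i ω) * (c' + b' ⬝ᵥ fun i => w i ω) ∂μ = c * c' + s * (b ⬝ᵥ b') := by
  have hi : ∀ i, Integrable (w i) μ := fun i => (hw.memLp i).integrable one_le_two
  have hlin : ∀ b : ι → ℝ, Integrable (fun ω => b ⬝ᵥ fun i => w i ω) μ := fun b =>
    integrable_finsetSum _ fun i _ => (hi i).const_mul (b i)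
  have hlin0 : ∀ b : ι → ℝ, ∫ ω, b ⬝ᵥ (fun i => w i ω) ∂μ = 0 := fun b => by
    simp only [dotProduct]
    rw [integral_finsetSum _ fun i _ => (hi i).const_mul (b i)]
    simp [integral_const_mul, hw.mean]
  have hq : ∀ ω, (b ⬝ᵥ fun i => w i ω) * (b' ⬝ᵥ fun i => w i ω)
      = ∑ i, ∑ j, (b i * b' j) * (w i ω * w j ω) := fun ω => by
    simp only [dotProduct, Finset.sum_mul_sum]
    exact Finset.sum_congr rfl fun i _ => Finset.sum_congr rfl fun j _ => by ring
  have hqi : Integrable (fun ω => (b ⬝ᵥ fun i => w i ω) * (b' ⬝ᵥ fun i => w i ω)) μ := by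
    simp only [hq]
    exact integrable_finsetSum _ fun i _ => integrable_finsetSum _ fun j _ =>
      (hw.integrable_mul i j).const_mul _
  have hqv : ∫ ω, (b ⬝ᵥ fun i => w i ω) * (b' ⬝ᵥ fun i => w i ω) ∂μ = s * (b ⬝ᵥ b') := by
    simp only [hq]
    rw [integral_finsetSum _ fun i _ => integrable_finsetSum _ fun j _ =>
      (hw.integrable_mul i j).const_mul _]
    simp_rw [integral_finsetSum _ fun j _ => (hw.integrable_mul _ j).const_mul _,
      integral_const_mul, hw.moment]
    simp [dotProduct, Finset.mul_sum, mul_comm]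
  have he : ∀ ω, (c + b ⬝ᵥ fun i => w i ω) * (c' + b' ⬝ᵥ fun i => w i ω)
      = (c * c' + (c * (b' ⬝ᵥ fun i => w i ω) + c' * (b ⬝ᵥ fun i => w i ω)))
        + (b ⬝ᵥ fun i => w i ω) * (b' ⬝ᵥ fun i => w i ω) := fun ω => by ring
  have hl1 : Integrable (fun ω => c * (b' ⬝ᵥ fun i => w i ω) + c' * (b ⬝ᵥ fun i => w i ω)) μ :=
    ((hlin b').const_mul c).add ((hlin b).const_mul c')
  have hl2 : Integrable (fun ω => c * c' + (c * (b' ⬝ᵥ fun i => w i ω)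
      + c' * (b ⬝ᵥ fun i => w i ω))) μ := (integrable_const _).add hl1
  simp only [he]
  rw [integral_add hl2 hqi, integral_add (integrable_const _) hl1,
    hqv, integral_add ((hlin b').const_mul c) ((hlin b).const_mul c')]
  simp [integral_const_mul, hlin0]

variable {m : ℕ}

lemma quadratic_eq_sum (A : Matrix (Fin m) (Fin m) ℝ) (x : Fin m → ℝ) :
    x ⬝ᵥ (A *ᵥ x) = ∑ i, ∑ j, A i j * (x i * x j) := by
  simp only [dotProduct, mulVec, Finset.mul_sum]
  exact Finset.sum_congr rfl fun i _ => Finset.sum_congr rfl fun j _ => by ring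

lemma IsWhite.integrable_quadratic (hw : IsWhite μ w s) (A : Matrix (Fin m) (Fin m) ℝ)
    (c : Fin m → ℝ) (B : Matrix (Fin m) ι ℝ) :
    Integrable (fun ω => (c + B *ᵥ fun i => w i ω) ⬝ᵥ (A *ᵥ (c + B *ᵥ fun i => w i ω))) μ := by
  simp only [quadratic_eq_sum]
  exact integrable_finsetSum _ fun i _ => integrable_finsetSum _ fun j _ =>
    ((hw.memLp_affine (c i) (B i)).integrable_mul (hw.memLp_affine (c j) (B j))).const_mul _

lemma IsWhite.integral_quadratic (hw : IsWhite μ w s) (A : Matrix (Fin m) (Fin m) ℝ)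
    (c : Fin m → ℝ) (B : Matrix (Fin m) ι ℝ) :
    ∫ ω, (c + B *ᵥ fun i => w i ω) ⬝ᵥ (A *ᵥ (c + B *ᵥ fun i => w i ω)) ∂μ
      = c ⬝ᵥ (A *ᵥ c) + s * (A * (B * Bᵀ)).trace := by
  have hint : ∀ i j, Integrable (fun ω => A i j * ((c + B *ᵥ fun i => w i ω) i
      * (c + B *ᵥ fun i => w i ω) j)) μ := fun i j =>
    ((hw.memLp_affine (c i) (B i)).integrable_mul (hw.memLp_affine (c j) (B j))).const_mul _
  have hval : ∀ i j, ∫ ω, (c + B *ᵥ fun i => w i ω) i * (c + B *ᵥ fun i => w i ω) j ∂μ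
      = c i * c j + s * (B i ⬝ᵥ B j) := fun i j =>
    hw.integral_affine_mul (c i) (c j) (B i) (B j)
  simp only [quadratic_eq_sum]
  rw [integral_finsetSum _ fun i _ => integrable_finsetSum _ fun j _ => hint i j]
  simp_rw [integral_finsetSum _ fun j _ => hint _ j, integral_const_mul, hval, mul_add,
    Finset.sum_add_distrib]
  congr 1
  simp only [trace, diag, Matrix.mul_apply, transpose_apply, dotProduct, Finset.mul_sum]
  refine Finset.sum_congr rfl fun i _ => Finset.sum_congr rfl fun j _ =>
    Finset.sum_congr rfl fun k _ => by ring

lemma IsWhite.integral_sqNorm (hw : IsWhite μ w s) (c : Fin m → ℝ) (B : Matrix (Fin m) ι ℝ) :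
    ∫ ω, sqNorm (c + B *ᵥ fun i => w i ω) ∂μ = sqNorm c + s * (B * Bᵀ).trace := by
  have h := hw.integral_quadratic 1 c B
  simpa only [one_mulVec, one_mul, ← sqNorm_eq_dotProduct] using h

end Quadratic

/-- The noise and its independent copy form a single white family, so `MSEy` becomes the mean square
of one affine function of white noise. -/
lemma IsWhite.prod [IsProbabilityMeasure μ] {ι : Type*} [DecidableEq ι] {w : ι → α → ℝ} {s : ℝ}
    (hw : IsWhite μ w s) :
    IsWhite (μ.prod μ)
      (Sum.elim (fun i (z : α × α) => w i z.1) (fun i (z : α × α) => w i z.2)) s where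
  memLp k := by
    cases k with
    | inl i => exact (hw.memLp i).comp_measurePreserving measurePreserving_fst
    | inr i => exact (hw.memLp i).comp_measurePreserving measurePreserving_snd
  mean k := by
    cases k with
    | inl i => simpa [hw.mean] using integral_fun_fst (μ := μ) (ν := μ) (w i)
    | inr i => simpa [hw.mean] using integral_fun_snd (μ := μ) (ν := μ) (w i)
  moment k k' := by
    rcases k with i | i <;> rcases k' with j | j
    · simpa [hw.moment] using integral_fun_fst (μ := μ) (ν := μ) (fun ω => w i ω * w j ω)
    · simpa [hw.mean] using integral_prod_mul (μ := μ) (ν := μ) (w i) (w j)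
    · have h := integral_prod_mul (μ := μ) (ν := μ) (w j) (w i)
      simpa [hw.mean, mul_comm] using h
    · simpa [hw.moment] using integral_fun_snd (μ := μ) (ν := μ) (fun ω => w i ω * w j ω)

end Moments

/-! ### Exact decompositions of the oracle criteria. -/

section OracleIdentities

variable {α : Type*} [MeasurableSpace α] {μ : Measure α} [IsProbabilityMeasure μ]
  {v : ℕ+ → α → ℝ} {n N : ℕ} {σ : ℝ} {Φ : Matrix (Fin N) (Fin n) ℝ}
  {P : Matrix (Fin n) (Fin n) ℝ}

lemma IsWhiteNoise.isWhite_fin (hv : IsWhiteNoise μ v σ) (N : ℕ) :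
    IsWhite μ (fun i : Fin N => v (Nat.succPNat i)) (σ ^ 2) :=
  hv.isWhite.comp_injective (Nat.succPNat_injective.comp Fin.val_injective)

lemma Rmat_inv_mul_gram_mul_Rmat_inv (hσ : 0 < σ) (hP : P.PosDef) :
    (Rmat σ Φ P)⁻¹ * (Φᵀ * Φ) * (Rmat σ Φ P)⁻¹
      = (Rmat σ Φ P)⁻¹ - σ ^ 2 • ((Rmat σ Φ P)⁻¹ * P⁻¹ * (Rmat σ Φ P)⁻¹) := by
  rw [Rmat_inv_mul_gram hσ hP, sub_mul, one_mul, smul_mul_assoc]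

lemma transpose_Rmat_inv (hσ : 0 < σ) (hP : P.PosDef) :
    ((Rmat σ Φ P)⁻¹)ᵀ = (Rmat σ Φ P)⁻¹ :=
  transpose_eq_of_posDef (posDef_Rmat hσ hP).inv

lemma thetaR_output (hσ : 0 < σ) (hP : P.PosDef) (θ₀ : Fin n → ℝ) (V : Fin N → ℝ) :
    thetaR σ Φ (output Φ θ₀ V) P
      = θ₀ - σ ^ 2 • ((Rmat σ Φ P)⁻¹ *ᵥ (P⁻¹ *ᵥ θ₀)) + ((Rmat σ Φ P)⁻¹ * Φᵀ) *ᵥ V := by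
  rw [thetaR_eq hσ hP, output, mulVec_add, mulVec_add, ← sub_Rmat_inv_mulVec_gram hσ hP,
    sub_sub_cancel]
  simp only [mulVec_mulVec]

lemma MSEg_eq (hv : IsWhiteNoise μ v σ) (hσ : 0 < σ) (hP : P.PosDef)
    (hG : IsUnit (Φᵀ * Φ).det) (θ₀ : Fin n → ℝ) :
    MSEg μ v σ θ₀ Φ P = σ ^ 2 * ((Φᵀ * Φ)⁻¹).trace
      + (σ ^ 4 * sqNorm ((Rmat σ Φ P)⁻¹ *ᵥ (P⁻¹ *ᵥ θ₀))
        - σ ^ 4 * ((Rmat σ Φ P)⁻¹ * P⁻¹ * (Φᵀ * Φ)⁻¹).trace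
        - σ ^ 4 * ((Rmat σ Φ P)⁻¹ * P⁻¹ * (Rmat σ Φ P)⁻¹).trace) := by
  have h1 : ∀ V, thetaR σ Φ (output Φ θ₀ V) P - θ₀
      = (-(σ ^ 2)) • ((Rmat σ Φ P)⁻¹ *ᵥ (P⁻¹ *ᵥ θ₀)) + ((Rmat σ Φ P)⁻¹ * Φᵀ) *ᵥ V := by
    intro V
    rw [thetaR_output hσ hP, neg_smul]
    abel
  have h2 : ((Rmat σ Φ P)⁻¹ * Φᵀ * ((Rmat σ Φ P)⁻¹ * Φᵀ)ᵀ).trace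
      = ((Φᵀ * Φ)⁻¹).trace - σ ^ 2 * ((Rmat σ Φ P)⁻¹ * P⁻¹ * (Φᵀ * Φ)⁻¹).trace
        - σ ^ 2 * ((Rmat σ Φ P)⁻¹ * P⁻¹ * (Rmat σ Φ P)⁻¹).trace := by
    rw [transpose_mul, transpose_transpose, transpose_Rmat_inv hσ hP, ← Matrix.mul_assoc,
      Matrix.mul_assoc _ Φᵀ Φ, Rmat_inv_mul_gram_mul_Rmat_inv hσ hP, trace_sub]
    -- Only the isolated `R⁻¹` is expanded around `(Φᵀ Φ)⁻¹`; the other term is already of order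
    -- `N⁻²`.
    conv_lhs => enter [1, 1]; rw [Rmat_inv_eq hσ hP hG]
    simp only [trace_sub, trace_smul, smul_eq_mul]
  simp only [MSEg, h1]
  have h3 := (hv.isWhite_fin N).integral_sqNorm
    ((-(σ ^ 2)) • ((Rmat σ Φ P)⁻¹ *ᵥ (P⁻¹ *ᵥ θ₀))) ((Rmat σ Φ P)⁻¹ * Φᵀ)
  rw [h2, sqNorm_smul] at h3
  refine h3.trans ?_
  ring

lemma MSEy_eq (hv : IsWhiteNoise μ v σ) (hσ : 0 < σ) (hP : P.PosDef) (θ₀ : Fin n → ℝ) :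
    MSEy μ v σ θ₀ Φ P = (σ ^ 2 * n + σ ^ 2 * N)
      + (σ ^ 4 * (((Rmat σ Φ P)⁻¹ *ᵥ (P⁻¹ *ᵥ θ₀))
          ⬝ᵥ ((Φᵀ * Φ) *ᵥ ((Rmat σ Φ P)⁻¹ *ᵥ (P⁻¹ *ᵥ θ₀))))
        - 2 * σ ^ 4 * ((Rmat σ Φ P)⁻¹ * P⁻¹).trace
        + σ ^ 6 * ((Rmat σ Φ P)⁻¹ * P⁻¹ * ((Rmat σ Φ P)⁻¹ * P⁻¹)).trace) := by
  have h1 : ∀ V V', output Φ θ₀ V' - Φ *ᵥ thetaR σ Φ (output Φ θ₀ V) P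
      = σ ^ 2 • (Φ *ᵥ ((Rmat σ Φ P)⁻¹ *ᵥ (P⁻¹ *ᵥ θ₀)))
        + fromCols (-(Φ * (Rmat σ Φ P)⁻¹ * Φᵀ)) 1 *ᵥ Sum.elim V V' := by
    intro V V'
    rw [thetaR_output hσ hP, fromCols_mulVec_sumElim, output, neg_mulVec, one_mulVec, mulVec_add,
      mulVec_sub, mulVec_smul, mulVec_mulVec V, Matrix.mul_assoc]
    abel
  have h2 : (fromCols (-(Φ * (Rmat σ Φ P)⁻¹ * Φᵀ)) (1 : Matrix (Fin N) (Fin N) ℝ)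
      * (fromCols (-(Φ * (Rmat σ Φ P)⁻¹ * Φᵀ)) (1 : Matrix (Fin N) (Fin N) ℝ))ᵀ).trace
      = n - 2 * σ ^ 2 * ((Rmat σ Φ P)⁻¹ * P⁻¹).trace
        + σ ^ 4 * ((Rmat σ Φ P)⁻¹ * P⁻¹ * ((Rmat σ Φ P)⁻¹ * P⁻¹)).trace + N := by
    have h3 : (Φ * (Rmat σ Φ P)⁻¹ * Φᵀ * (Φ * (Rmat σ Φ P)⁻¹ * Φᵀ)).trace
        = ((Rmat σ Φ P)⁻¹ * (Φᵀ * Φ) * ((Rmat σ Φ P)⁻¹ * (Φᵀ * Φ))).trace := by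
      rw [Matrix.mul_assoc Φ, Matrix.mul_assoc Φ, trace_mul_comm]
      simp only [Matrix.mul_assoc]
    rw [transpose_fromCols, fromCols_mul_fromRows, transpose_neg, transpose_mul, transpose_mul,
      transpose_transpose, transpose_Rmat_inv hσ hP, transpose_one, neg_mul_neg, one_mul,
      trace_add, ← Matrix.mul_assoc Φ, h3, Rmat_inv_mul_gram hσ hP]
    simp only [sub_mul, mul_sub, mul_one, one_mul, smul_mul_assoc, mul_smul_comm, trace_sub,
      trace_smul, trace_one, Fintype.card_fin, smul_eq_mul]
    ring
  have h3 := (hv.isWhite_fin N).prod.integral_sqNorm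
    (σ ^ 2 • (Φ *ᵥ ((Rmat σ Φ P)⁻¹ *ᵥ (P⁻¹ *ᵥ θ₀))))
    (fromCols (-(Φ * (Rmat σ Φ P)⁻¹ * Φᵀ)) 1)
  rw [h2, sqNorm_smul, sqNorm_mulVec] at h3
  have h4 : ∀ z : α × α, (fun k => Sum.elim (fun (i : Fin N) (z : α × α) => v (Nat.succPNat i) z.1)
      (fun (i : Fin N) (z : α × α) => v (Nat.succPNat i) z.2) k z)
      = Sum.elim (noiseVec N fun t => v t z.1) (noiseVec N fun t => v t z.2) := by
    intro z
    funext k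
    cases k <;> rfl
  simp only [h4] at h3
  simp only [MSEy, h1]
  rw [h3]
  ring

lemma thetaLS_mulVec (hG : IsUnit (Φᵀ * Φ).det) (θ : Fin n → ℝ) :
    thetaLS Φ (Φ *ᵥ θ) = θ := by
  rw [thetaLS, mulVec_mulVec, Matrix.mul_assoc, nonsing_inv_mul _ hG, one_mulVec]

lemma trace_Qmat_inv (hσ : 0 < σ) (hP : P.PosDef) :
    σ ^ 2 * ((Qmat σ Φ P)⁻¹).trace = N - n + σ ^ 2 * ((Rmat σ Φ P)⁻¹ * P⁻¹).trace := by
  have hs : σ ^ 2 ≠ 0 := by positivity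
  rw [Qmat_inv hσ hP, trace_smul, trace_sub, Matrix.mul_assoc, trace_mul_comm Φ, Matrix.mul_assoc,
    Rmat_inv_mul_gram hσ hP, trace_sub, trace_smul, trace_one, trace_one]
  simp only [smul_eq_mul, Fintype.card_fin]
  field_simp
  ring

lemma EEB_eq (hv : IsWhiteNoise μ v σ) (hσ : 0 < σ) (hP : P.PosDef)
    (hG : IsUnit (Φᵀ * Φ).det) (θ₀ : Fin n → ℝ) :
    EEB μ v σ θ₀ Φ P = ((σ ^ 2)⁻¹ * ((Φ *ᵥ θ₀) ⬝ᵥ (Φ *ᵥ θ₀) - θ₀ ⬝ᵥ ((Φᵀ * Φ) *ᵥ θ₀))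
        + Real.log ((σ ^ 2) ^ N * ((σ ^ 2)⁻¹) ^ n) + (N - n))
      + (θ₀ ⬝ᵥ (P⁻¹ *ᵥ θ₀)
        - σ ^ 2 * (θ₀ ⬝ᵥ ((P⁻¹ * (Rmat σ Φ P)⁻¹ * P⁻¹) *ᵥ θ₀))
        + σ ^ 2 * ((Rmat σ Φ P)⁻¹ * P⁻¹).trace
        + Real.log P.det + Real.log (Rmat σ Φ P).det) := by
  -- Averaging leaves the criterion at noise-free data, where least squares returns `θ₀` exactly,
  -- plus a variance trace.
  have h1 : EEB μ v σ θ₀ Φ P = FEB σ Φ (Φ *ᵥ θ₀) P + σ ^ 2 * ((Qmat σ Φ P)⁻¹).trace := by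
    have hint := (hv.isWhite_fin N).integrable_quadratic (Qmat σ Φ P)⁻¹ (Φ *ᵥ θ₀) 1
    have hval := (hv.isWhite_fin N).integral_quadratic (Qmat σ Φ P)⁻¹ (Φ *ᵥ θ₀) 1
    simp only [one_mulVec, transpose_one, mul_one] at hint hval
    simp only [EEB, FEB, output]
    refine (integral_add hint (integrable_const _)).trans ?_
    rw [hval]
    simp
    ring
  rw [h1, FEB_eq hσ hP hG, thetaLS_mulVec hG, trace_Qmat_inv hσ hP]
  ring

end OracleIdentities

/-! ### A strong law for weighted sums of uncorrelated variables. -/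

section LawOfLargeNumbers

variable {α : Type*} [MeasurableSpace α] {μ : Measure α}

/-- The sum of the `f m` has finite integral, hence is finite almost everywhere, so its terms
vanish. -/
lemma ae_tendsto_zero_of_summable_integral {f : ℕ → α → ℝ} (h0 : ∀ m ω, 0 ≤ f m ω)
    (hi : ∀ m, Integrable (f m) μ) (hs : Summable fun m => ∫ ω, f m ω ∂μ) :
    ∀ᵐ ω ∂μ, Tendsto (fun m => f m ω) atTop (𝓝 0) := by
  have hm : ∀ m, AEMeasurable (fun ω => ENNReal.ofReal (f m ω)) μ := fun m =>
    (hi m).aestronglyMeasurable.aemeasurable.ennreal_ofReal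
  have h1 : ∫⁻ ω, ∑' m, ENNReal.ofReal (f m ω) ∂μ ≠ ⊤ := by
    rw [lintegral_tsum hm]
    simp_rw [← ofReal_integral_eq_lintegral_ofReal (hi _) (Eventually.of_forall (h0 _))]
    exact hs.tsum_ofReal_ne_top
  filter_upwards [ae_lt_top' (AEMeasurable.tsum hm) h1] with ω hω
  have h2 := ENNReal.tendsto_atTop_zero_of_tsum_ne_top hω.ne
  have h3 := (ENNReal.tendsto_toReal ENNReal.zero_ne_top).comp h2
  simpa [Function.comp_def, ENNReal.toReal_ofReal (h0 _ ω)] using h3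

/-- Abel summation: quadratic growth of `A` is weighed against the increments of `1 / m³`, which
have order `m⁻⁴`. Individual increments of `A` need not be of order `m`. -/
lemma summable_sub_div_cube {A : ℕ → ℝ} {C : ℝ} (hA0 : ∀ m, 0 ≤ A m)
    (hmono : ∀ m, A m ≤ A (m + 1)) (hA : ∀ m, A m ≤ C * (m : ℝ) ^ 2) :
    Summable fun m : ℕ => (A (m + 2) - A (m + 1)) / ((m : ℝ) + 1) ^ 3 := by
  have hC : 0 ≤ C := by simpa using (hA0 1).trans (hA 1)
  have hsq : Summable fun m : ℕ => 6 * C / ((m : ℝ) + 1) ^ 2 := by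
    have h := (summable_nat_add_iff 1).2 (Real.summable_one_div_nat_pow.2 one_lt_two)
    simpa [div_eq_mul_inv] using h.mul_left (6 * C)
  have hterm : ∀ m : ℕ, (A (m + 2) - A (m + 1)) / ((m : ℝ) + 1) ^ 3
      ≤ (A (m + 2) / ((m : ℝ) + 2) ^ 3 - A (m + 1) / ((m : ℝ) + 1) ^ 3)
        + 6 * C / ((m : ℝ) + 1) ^ 2 := by
    intro m
    have hm : (0 : ℝ) ≤ m := m.cast_nonneg
    have h1 : A (m + 2) ≤ C * ((m : ℝ) + 2) ^ 2 := by simpa using hA (m + 2)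
    have h2 : 1 / ((m : ℝ) + 1) ^ 3 - 1 / ((m : ℝ) + 2) ^ 3
        ≤ 6 / (((m : ℝ) + 1) ^ 2 * ((m : ℝ) + 2) ^ 2) := by
      rw [div_sub_div _ _ (by positivity) (by positivity), div_le_div_iff₀ (by positivity)
        (by positivity)]
      -- The constant `6` works since `6 (m + 1) (m + 2) - (3 m² + 9 m + 7) = 3 m² + 9 m + 5`.
      have h3 : 0 ≤ ((m : ℝ) + 1) ^ 2 * ((m : ℝ) + 2) ^ 2 * (3 * (m : ℝ) ^ 2 + 9 * m + 5) := by
        positivity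
      nlinarith
    have h0 : 0 ≤ 1 / ((m : ℝ) + 1) ^ 3 - 1 / ((m : ℝ) + 2) ^ 3 := by
      rw [sub_nonneg]
      gcongr
      norm_num
    have h4 := mul_le_mul h1 h2 h0 (by positivity)
    have h5 : C * ((m : ℝ) + 2) ^ 2 * (6 / (((m : ℝ) + 1) ^ 2 * ((m : ℝ) + 2) ^ 2))
        = 6 * C / ((m : ℝ) + 1) ^ 2 := by
      field_simp
    rw [h5] at h4
    have h6 : (A (m + 2) - A (m + 1)) / ((m : ℝ) + 1) ^ 3
        = (A (m + 2) / ((m : ℝ) + 2) ^ 3 - A (m + 1) / ((m : ℝ) + 1) ^ 3)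
          + A (m + 2) * (1 / ((m : ℝ) + 1) ^ 3 - 1 / ((m : ℝ) + 2) ^ 3) := by ring
    linarith
  refine summable_of_sum_range_le (c := C + ∑' m : ℕ, 6 * C / ((m : ℝ) + 1) ^ 2)
    (fun m => div_nonneg (sub_nonneg.2 (hmono _)) (by positivity)) fun M => ?_
  have htel : ∑ m ∈ Finset.range M,
      (A (m + 2) / ((m : ℝ) + 2) ^ 3 - A (m + 1) / ((m : ℝ) + 1) ^ 3)
      = A (M + 1) / ((M : ℝ) + 1) ^ 3 - A 1 := by
    have h := Finset.sum_range_sub (fun m : ℕ => A (m + 1) / ((m : ℝ) + 1) ^ 3) M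
    simp only [Nat.cast_add, Nat.cast_one, add_assoc, one_add_one_eq_two] at h
    simpa using h
  have hlast : A (M + 1) / ((M : ℝ) + 1) ^ 3 ≤ C := by
    rw [div_le_iff₀ (by positivity)]
    have h1 : A (M + 1) ≤ C * ((M : ℝ) + 1) ^ 2 := by simpa using hA (M + 1)
    refine h1.trans (mul_le_mul_of_nonneg_left ?_ hC)
    exact pow_le_pow_right₀ (by simp) (by norm_num)
  calc ∑ m ∈ Finset.range M, (A (m + 2) - A (m + 1)) / ((m : ℝ) + 1) ^ 3
      ≤ ∑ m ∈ Finset.range M, ((A (m + 2) / ((m : ℝ) + 2) ^ 3 - A (m + 1) / ((m : ℝ) + 1) ^ 3)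
        + 6 * C / ((m : ℝ) + 1) ^ 2) := Finset.sum_le_sum fun m _ => hterm m
    _ = (A (M + 1) / ((M : ℝ) + 1) ^ 3 - A 1)
        + ∑ m ∈ Finset.range M, 6 * C / ((m : ℝ) + 1) ^ 2 := by
      rw [Finset.sum_add_distrib, htel]
    _ ≤ _ := by
      have h1 := hsq.sum_le_tsum (Finset.range M) (fun m _ => by positivity)
      have := hA0 1
      linarith

lemma IsWhite.integral_sum_sq [IsProbabilityMeasure μ] {w : ℕ → α → ℝ} {s : ℝ}
    (hw : IsWhite μ w s) (a : ℕ → ℝ) (N : ℕ) :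
    Integrable (fun ω => (∑ t ∈ Finset.range N, a t * w t ω) ^ 2) μ ∧
      ∫ ω, (∑ t ∈ Finset.range N, a t * w t ω) ^ 2 ∂μ
        = s * ∑ t ∈ Finset.range N, a t ^ 2 := by
  have hw' : IsWhite μ (fun i : Fin N => w i) s := hw.comp_injective Fin.val_injective
  have he : ∀ ω, (∑ t ∈ Finset.range N, a t * w t ω) ^ 2
      = (0 + (fun i : Fin N => a i) ⬝ᵥ fun i : Fin N => w i ω)
        * (0 + (fun i : Fin N => a i) ⬝ᵥ fun i : Fin N => w i ω) := fun ω => by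
    rw [Finset.sum_range, zero_add, sq]
    rfl
  simp only [he]
  refine ⟨(hw'.memLp_affine _ _).integrable_mul (hw'.memLp_affine _ _), ?_⟩
  rw [hw'.integral_affine_mul, Finset.sum_range]
  simp [dotProduct, sq]

/-- Strong law of large numbers for a weighted sum of orthogonal random variables. -/
theorem IsWhite.ae_tendsto_average [IsProbabilityMeasure μ] {w : ℕ → α → ℝ} {s : ℝ}
    (hw : IsWhite μ w s) {a : ℕ → ℝ} {C : ℝ}
    (hC : ∀ N : ℕ, ∑ t ∈ Finset.range N, a t ^ 2 ≤ C * N) :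
    ∀ᵐ ω ∂μ, Tendsto (fun N : ℕ => (N : ℝ)⁻¹ * ∑ t ∈ Finset.range N, a t * w t ω)
      atTop (𝓝 0) := by
  set A : ℕ → ℝ := fun m => ∑ t ∈ Finset.range (m ^ 2), a t ^ 2 with hAdef
  set X : ℕ → α → ℝ := fun N ω => ∑ t ∈ Finset.range N, a t * w t ω with hX
  set B : ℕ → α → ℝ := fun m ω => ∑ t ∈ Finset.Ico ((m + 1) ^ 2) ((m + 2) ^ 2), w t ω ^ 2 with hB
  have hs0 : 0 ≤ s := by
    have h := hw.moment 0 0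
    rw [if_pos rfl] at h
    rw [← h]
    exact integral_nonneg fun ω => mul_self_nonneg _
  have hA0 : ∀ m, 0 ≤ A m := fun m => Finset.sum_nonneg fun t _ => sq_nonneg _
  have hblock : ∀ m, A (m + 2) - A (m + 1)
      = ∑ t ∈ Finset.Ico ((m + 1) ^ 2) ((m + 2) ^ 2), a t ^ 2 := fun m =>
    (Finset.sum_Ico_eq_sub _ (Nat.pow_le_pow_left (by omega) 2)).symm
  have hmono : ∀ m, A m ≤ A (m + 1) := fun m =>
    Finset.sum_le_sum_of_subset_of_nonneg
      (Finset.range_mono (Nat.pow_le_pow_left (by omega) 2)) fun t _ _ => sq_nonneg _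
  have hA : ∀ m, A m ≤ C * (m : ℝ) ^ 2 := fun m => by
    have h := hC (m ^ 2)
    push_cast at h
    exact h
  have hC0 : 0 ≤ C := by simpa using (hA0 1).trans (hA 1)
  have hwsq : ∀ t, Integrable (fun ω => w t ω ^ 2) μ := fun t => (hw.memLp t).integrable_sq
  have hBi : ∀ m, Integrable (B m) μ := fun m => integrable_finsetSum _ fun t _ => hwsq t
  have hBv : ∀ m : ℕ, ∫ ω, B m ω ∂μ = s * (2 * m + 3) := by
    intro m
    have h1 : ∀ t, ∫ ω, w t ω ^ 2 ∂μ = s := fun t => by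
      simpa [sq] using hw.moment t t
    simp only [hB]
    rw [integral_finsetSum _ fun t _ => hwsq t]
    simp only [h1, Finset.sum_const, Nat.card_Ico, nsmul_eq_mul]
    rw [Nat.cast_sub (Nat.pow_le_pow_left (by omega) 2)]
    push_cast
    ring
  -- Up to a factor `2`, this bounds the squared average for all `N` between `(m + 1)²` and `(m +
  -- 2)²`: the value at the left end plus a Cauchy–Schwarz bound for the rest of the block.
  set f : ℕ → α → ℝ := fun m ω =>
    (X ((m + 1) ^ 2) ω ^ 2 + (A (m + 2) - A (m + 1)) * B m ω) / ((m : ℝ) + 1) ^ 4 with hf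
  have hB0 : ∀ m ω, 0 ≤ B m ω := fun m ω => Finset.sum_nonneg fun t _ => sq_nonneg _
  have hf0 : ∀ m ω, 0 ≤ f m ω := fun m ω =>
    div_nonneg (add_nonneg (sq_nonneg _)
      (mul_nonneg (sub_nonneg.2 (hmono _)) (hB0 m ω))) (by positivity)
  have hXi := fun N => hw.integral_sum_sq a N
  have hfi : ∀ m, Integrable (f m) μ := fun m =>
    ((hXi _).1.add ((hBi m).const_mul _)).div_const _
  have hfv : ∀ m : ℕ, ∫ ω, f m ω ∂μ
      = (s * A (m + 1) + (A (m + 2) - A (m + 1)) * (s * (2 * m + 3))) / ((m : ℝ) + 1) ^ 4 := by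
    intro m
    simp only [hf]
    rw [integral_div, integral_add (hXi _).1 ((hBi m).const_mul _), integral_const_mul, hBv,
      (hXi _).2]
  have hsum : Summable fun m => ∫ ω, f m ω ∂μ := by
    have hsq : Summable fun m : ℕ => s * C * (1 / ((m : ℝ) + 1) ^ 2) := by
      have h := (summable_nat_add_iff 1).2 (Real.summable_one_div_nat_pow.2 one_lt_two)
      simpa using h.mul_left (s * C)
    refine Summable.of_nonneg_of_le (fun m => integral_nonneg (hf0 m)) (fun m => ?_)
      (hsq.add ((summable_sub_div_cube hA0 hmono hA).mul_left (3 * s)))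
    rw [hfv, add_div]
    have hm : (0 : ℝ) ≤ m := m.cast_nonneg
    refine add_le_add ?_ ?_
    · rw [div_le_iff₀ (by positivity)]
      have h1 : A (m + 1) ≤ C * ((m : ℝ) + 1) ^ 2 := by simpa using hA (m + 1)
      calc s * A (m + 1) ≤ s * (C * ((m : ℝ) + 1) ^ 2) := mul_le_mul_of_nonneg_left h1 hs0
        _ = _ := by field_simp
    · rw [div_le_iff₀ (by positivity)]
      have h1 : 0 ≤ A (m + 2) - A (m + 1) := sub_nonneg.2 (hmono _)
      calc (A (m + 2) - A (m + 1)) * (s * (2 * m + 3))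
          ≤ (A (m + 2) - A (m + 1)) * (s * (3 * (m + 1))) := by gcongr; linarith
        _ = _ := by field_simp
  filter_upwards [ae_tendsto_zero_of_summable_integral hf0 hfi hsum] with ω hω
  have hbound : ∀ m N : ℕ, (m + 1) ^ 2 ≤ N → N ≤ (m + 2) ^ 2 →
      ((N : ℝ)⁻¹ * X N ω) ^ 2 ≤ 2 * f m ω := by
    intro m N h1 h2
    have hsplit : X N ω = X ((m + 1) ^ 2) ω + ∑ t ∈ Finset.Ico ((m + 1) ^ 2) N, a t * w t ω := by
      rw [Finset.sum_Ico_eq_sub _ h1]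
      ring
    have hsub : Finset.Ico ((m + 1) ^ 2) N ⊆ Finset.Ico ((m + 1) ^ 2) ((m + 2) ^ 2) :=
      Finset.Ico_subset_Ico_right h2
    have hcs : (∑ t ∈ Finset.Ico ((m + 1) ^ 2) N, a t * w t ω) ^ 2
        ≤ (A (m + 2) - A (m + 1)) * B m ω := by
      refine (Finset.sum_mul_sq_le_sq_mul_sq _ _ _).trans ?_
      rw [hblock]
      exact mul_le_mul (Finset.sum_le_sum_of_subset_of_nonneg hsub fun t _ _ => sq_nonneg _)
        (Finset.sum_le_sum_of_subset_of_nonneg hsub fun t _ _ => sq_nonneg _)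
        (Finset.sum_nonneg fun t _ => sq_nonneg _) (Finset.sum_nonneg fun t _ => sq_nonneg _)
    have hN : ((m : ℝ) + 1) ^ 2 ≤ N := by exact_mod_cast h1
    have hN4 : ((m : ℝ) + 1) ^ 4 ≤ (N : ℝ) ^ 2 := by
      calc ((m : ℝ) + 1) ^ 4 = (((m : ℝ) + 1) ^ 2) ^ 2 := by ring
        _ ≤ _ := by gcongr
    have hXN : X N ω ^ 2 ≤ 2 * (X ((m + 1) ^ 2) ω ^ 2 + (A (m + 2) - A (m + 1)) * B m ω) := by
      rw [hsplit]
      refine (add_sq_le).trans ?_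
      gcongr
    have h0 : 0 ≤ 2 * (X ((m + 1) ^ 2) ω ^ 2 + (A (m + 2) - A (m + 1)) * B m ω) :=
      (sq_nonneg _).trans hXN
    calc ((N : ℝ)⁻¹ * X N ω) ^ 2 = X N ω ^ 2 / (N : ℝ) ^ 2 := by
          rw [mul_pow, inv_pow, div_eq_inv_mul]
      _ ≤ (2 * (X ((m + 1) ^ 2) ω ^ 2 + (A (m + 2) - A (m + 1)) * B m ω)) / ((m : ℝ) + 1) ^ 4 :=
          div_le_div₀ h0 hXN (by positivity) hN4
      _ = 2 * f m ω := by simp only [hf]; ring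
  -- The block containing `N` has index `Nat.sqrt N - 1`; the truncated subtraction is harmless for
  -- `N ≥ 1`.
  have hsqrt : Tendsto (fun N : ℕ => Nat.sqrt N - 1) atTop atTop := by
    refine tendsto_atTop.2 fun b => ?_
    filter_upwards [eventually_ge_atTop ((b + 1) ^ 2)] with N hN
    have := Nat.le_sqrt'.2 hN
    omega
  have hlim : Tendsto (fun N : ℕ => Real.sqrt (2 * f (Nat.sqrt N - 1) ω)) atTop (𝓝 0) := by
    have h := ((hω.comp hsqrt).const_mul 2).sqrt
    simpa using h
  refine squeeze_zero_norm' ?_ hlim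
  filter_upwards [eventually_ge_atTop 1] with N hN
  have h1 : 1 ≤ Nat.sqrt N := Nat.le_sqrt'.2 (by simpa using hN)
  refine Real.abs_le_sqrt (hbound _ N ?_ ?_)
  · rw [Nat.sub_add_cancel h1]
    exact Nat.sqrt_le' N
  · rw [show Nat.sqrt N - 1 + 2 = Nat.sqrt N + 1 by omega]
    exact (Nat.lt_succ_sqrt' N).le

/-- By independence the joint law is a product, so Fubini reduces to deterministic weights. The
bound `C` may depend on `ω`; taking it in `ℕ` makes its existence a countable union, hence
measurable. -/
theorem IsWhite.ae_tendsto_average_of_indepFun [IsProbabilityMeasure μ] {a w : ℕ → α → ℝ} {s : ℝ}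
    (hw : IsWhite μ w s) (ha : ∀ t, Measurable (a t))
    (hind : IndepFun (fun ω t => a t ω) (fun ω t => w t ω) μ)
    (hC : ∀ᵐ ω ∂μ, ∃ C : ℕ, ∀ N : ℕ, ∑ t ∈ Finset.range N, a t ω ^ 2 ≤ C * N) :
    ∀ᵐ ω ∂μ, Tendsto (fun N : ℕ => (N : ℝ)⁻¹ * ∑ t ∈ Finset.range N, a t ω * w t ω)
      atTop (𝓝 0) := by
  set p : (ℕ → ℝ) × (ℕ → ℝ) → Prop := fun z =>
    (∃ C : ℕ, ∀ N : ℕ, ∑ t ∈ Finset.range N, z.1 t ^ 2 ≤ C * N) →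
      Tendsto (fun N : ℕ => (N : ℝ)⁻¹ * ∑ t ∈ Finset.range N, z.1 t * z.2 t) atTop (𝓝 0) with hp
  have ham : AEMeasurable (fun ω t => a t ω) μ := (measurable_pi_lambda _ ha).aemeasurable
  have hwm : AEMeasurable (fun ω t => w t ω) μ :=
    aemeasurable_pi_lambda _ fun t => (hw.memLp t).aestronglyMeasurable.aemeasurable
  have hpm : MeasurableSet {z | p z} := by
    have h1 : MeasurableSet {z : (ℕ → ℝ) × (ℕ → ℝ) |
        ∃ C : ℕ, ∀ N : ℕ, ∑ t ∈ Finset.range N, z.1 t ^ 2 ≤ C * N} := by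
      simp only [Set.ofPred_exists, Set.ofPred_forall]
      refine MeasurableSet.iUnion fun C => MeasurableSet.iInter fun N =>
        measurableSet_le ?_ measurable_const
      fun_prop
    have h2 : MeasurableSet {z : (ℕ → ℝ) × (ℕ → ℝ) | Tendsto (fun N : ℕ =>
        (N : ℝ)⁻¹ * ∑ t ∈ Finset.range N, z.1 t * z.2 t) atTop (𝓝 0)} := by
      refine measurableSet_tendsto _ fun N => ?_
      fun_prop
    exact h1.imp h2
  have hae : ∀ᵐ z ∂(μ.map fun ω t => a t ω).prod (μ.map fun ω t => w t ω), p z := by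
    have : IsProbabilityMeasure (μ.map fun ω t => w t ω) := Measure.isProbabilityMeasure_map hwm
    rw [Measure.ae_prod_iff_ae_ae hpm]
    refine Eventually.of_forall fun x => ?_
    have hx : MeasurableSet {y | p (x, y)} := measurable_prodMk_left hpm
    rw [ae_map_iff hwm hx]
    by_cases hx : ∃ C : ℕ, ∀ N : ℕ, ∑ t ∈ Finset.range N, x t ^ 2 ≤ C * N
    · obtain ⟨C, hC⟩ := hx
      filter_upwards [hw.ae_tendsto_average hC] with ω hω _
      exact hω
    · exact Eventually.of_forall fun ω h => absurd h hx
  rw [← (indepFun_iff_map_prod_eq_prod_map_map ham hwm).1 hind] at hae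
  filter_upwards [ae_of_ae_map (ham.prodMk hwm) hae, hC] with ω h1 h2
  exact h1 h2

end LawOfLargeNumbers

/-! ### Entrywise matrix calculus. -/

section Derivatives

variable {m : ℕ} {A : ℝ → Matrix (Fin m) (Fin m) ℝ} {D : Matrix (Fin m) (Fin m) ℝ} {x : ℝ}

/-- Jacobi's formula: differentiating the Leibniz expansion replaces one column of `A` at a time by
that of `D`, and Cramer's rule collects these determinants into the adjugate. -/
lemma hasDerivAt_matrix_det (hA : ∀ k l, HasDerivAt (fun t => A t k l) (D k l) x) :
    HasDerivAt (fun t => (A t).det) ((A x).adjugate * D).trace x := by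
  have h1 : HasDerivAt (fun t => (A t).det)
      (∑ τ : Equiv.Perm (Fin m), (Equiv.Perm.sign τ : ℝ) *
        ∑ i, (∏ j ∈ Finset.univ.erase i, A x (τ j) j) • D (τ i) i) x := by
    simp only [det_apply']
    exact HasDerivAt.fun_sum fun τ _ =>
      (HasDerivAt.fun_finsetProd fun i _ => hA (τ i) i).const_mul _
  convert h1 using 1
  have h2 : ((A x).adjugate * D).trace = ∑ i, ((A x).updateCol i (fun k => D k i)).det := by
    simp only [trace, diag]
    refine Finset.sum_congr rfl fun i _ => ?_
    rw [← cramer_apply, cramer_eq_adjugate_mulVec]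
    rfl
  rw [h2]
  simp only [det_apply', Finset.mul_sum]
  rw [Finset.sum_comm]
  refine Finset.sum_congr rfl fun τ _ => Finset.sum_congr rfl fun i _ => ?_
  rw [← Finset.prod_erase_mul _ _ (Finset.mem_univ i), updateCol_self, smul_eq_mul]
  congr 2
  exact Finset.prod_congr rfl fun j hj => updateCol_ne (Finset.ne_of_mem_erase hj)

/-- Limit of the slopes in `A(t)⁻¹ - A(x)⁻¹ = -A(t)⁻¹ (A(t) - A(x)) A(x)⁻¹`. -/
lemma hasDerivAt_matrix_inv (hA : ∀ k l, HasDerivAt (fun t => A t k l) (D k l) x)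
    (hx : (A x).det ≠ 0) (k l : Fin m) :
    HasDerivAt (fun t => (A t)⁻¹ k l) ((-((A x)⁻¹ * D * (A x)⁻¹)) k l) x := by
  have hcont : Tendsto A (𝓝 x) (𝓝 (A x)) :=
    tendsto_pi_nhds.2 fun k => tendsto_pi_nhds.2 fun l => (hA k l).continuousAt
  have hinv := tendsto_matrix_inv hcont hx
  have hslope : Tendsto (fun t => (t - x)⁻¹ • (A t - A x)) (𝓝[≠] x) (𝓝 D) :=
    tendsto_pi_nhds.2 fun k => tendsto_pi_nhds.2 fun l =>
      hasDerivAt_iff_tendsto_slope.1 (hA k l)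
  have hprod : Tendsto (fun t => -((A t)⁻¹ * ((t - x)⁻¹ • (A t - A x)) * (A x)⁻¹)) (𝓝[≠] x)
      (𝓝 (-((A x)⁻¹ * D * (A x)⁻¹))) :=
    (((hinv.mono_left nhdsWithin_le_nhds).mul hslope).mul tendsto_const_nhds).neg
  rw [hasDerivAt_iff_tendsto_slope]
  refine ((tendsto_pi_nhds.1 (tendsto_pi_nhds.1 hprod k) l)).congr' ?_
  have hdet : ∀ᶠ t in 𝓝[≠] x, (A t).det ≠ 0 :=
    (((((continuous_id.matrix_det).tendsto (A x)).comp hcont).eventually_ne hx).filter_mono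
      nhdsWithin_le_nhds)
  filter_upwards [hdet] with t ht
  have h1 : -((A t)⁻¹ * ((t - x)⁻¹ • (A t - A x)) * (A x)⁻¹)
      = (t - x)⁻¹ • ((A t)⁻¹ - (A x)⁻¹) := by
    rw [mul_smul_comm, smul_mul_assoc, mul_sub, sub_mul, nonsing_inv_mul _ ht.isUnit, one_mul,
      mul_nonsing_inv_cancel_right _ _ hx.isUnit, ← smul_neg, neg_sub]
  rw [h1]
  rfl

lemma hasDerivAt_mulVec (hA : ∀ k l, HasDerivAt (fun t => A t k l) (D k l) x)
    (θ : Fin m → ℝ) (i : Fin m) : HasDerivAt (fun t => (A t *ᵥ θ) i) ((D *ᵥ θ) i) x := by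
  simp only [mulVec, dotProduct]
  exact HasDerivAt.fun_sum fun j _ => (hA i j).mul_const (θ j)

lemma hasDerivAt_const_mulVec {y : ℝ → Fin m → ℝ} {y' : Fin m → ℝ}
    (hy : ∀ i, HasDerivAt (fun t => y t i) (y' i) x) (B : Matrix (Fin m) (Fin m) ℝ) (i : Fin m) :
    HasDerivAt (fun t => (B *ᵥ y t) i) ((B *ᵥ y') i) x := by
  simp only [mulVec, dotProduct]
  exact HasDerivAt.fun_sum fun j _ => (hy j).const_mul (B i j)

lemma hasDerivAt_trace_mul (hA : ∀ k l, HasDerivAt (fun t => A t k l) (D k l) x)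
    (B : Matrix (Fin m) (Fin m) ℝ) : HasDerivAt (fun t => (B * A t).trace) (B * D).trace x := by
  simp only [trace, diag, Matrix.mul_apply]
  exact HasDerivAt.fun_sum fun i _ => HasDerivAt.fun_sum fun j _ => (hA j i).const_mul (B i j)

lemma hasDerivAt_dotProduct {y z : ℝ → Fin m → ℝ} {y' z' : Fin m → ℝ}
    (hy : ∀ i, HasDerivAt (fun t => y t i) (y' i) x)
    (hz : ∀ i, HasDerivAt (fun t => z t i) (z' i) x) :
    HasDerivAt (fun t => y t ⬝ᵥ z t) (y' ⬝ᵥ z x + y x ⬝ᵥ z') x := by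
  have h : HasDerivAt (fun t => y t ⬝ᵥ z t) (∑ i, (y' i * z x i + y x i * z' i)) x :=
    HasDerivAt.fun_sum fun i _ => (hy i).mul (hz i)
  rwa [Finset.sum_add_distrib] at h

lemma trace_mul_vecMulVec_mul (M M' : Matrix (Fin m) (Fin m) ℝ) (a b : Fin m → ℝ) :
    (M * vecMulVec a b * M').trace = b ⬝ᵥ ((M' * M) *ᵥ a) := by
  rw [trace_mul_comm, ← Matrix.mul_assoc, mul_vecMulVec, trace_vecMulVec, dotProduct_comm]

end Derivatives

/-! ### First-order conditions at interior minimizers. -/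

section Stationarity

variable {n p : ℕ} {Ω : Set (EuclideanSpace ℝ (Fin p))}
  {P : EuclideanSpace ℝ (Fin p) → Matrix (Fin n) (Fin n) ℝ} {D : Matrix (Fin n) (Fin n) ℝ}
  {η : EuclideanSpace ℝ (Fin p)} {i : Fin p}

lemma eventually_line_mem (hη : η ∈ interior Ω) (e : EuclideanSpace ℝ (Fin p)) :
    ∀ᶠ t : ℝ in 𝓝 0, η + t • e ∈ Ω := by
  have h : Tendsto (fun t : ℝ => η + t • e) (𝓝 0) (𝓝 η) := by
    have : Continuous fun t : ℝ => η + t • e := by fun_prop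
    simpa using this.tendsto 0
  exact h.eventually (mem_interior_iff_mem_nhds.1 hη)

lemma derivative_eq_zero_of_mem_argminSet {W : EuclideanSpace ℝ (Fin p) → ℝ}
    {e : EuclideanSpace ℝ (Fin p)} {W' : ℝ}
    (hη : η ∈ argminSet W Ω ∩ interior Ω) (hW : HasDerivAt (fun t : ℝ => W (η + t • e)) W' 0) :
    W' = 0 := by
  refine IsLocalMin.hasDerivAt_eq_zero ?_ hW
  filter_upwards [eventually_line_mem hη.2 e] with t ht
  simpa using hη.1.2 ht

lemma HasPartialDeriv.transpose_eq (hD : HasPartialDeriv P D η i) (hη : η ∈ interior Ω)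
    (hP : ∀ η ∈ Ω, (P η).PosDef) : Dᵀ = D := by
  ext k l
  have hkl : HasDerivAt (fun t : ℝ => P (η + t • EuclideanSpace.single i 1) k l) (D k l) 0 :=
    hD k l
  refine HasDerivAt.unique (hD l k) (hkl.congr_of_eventuallyEq ?_)
  filter_upwards [eventually_line_mem hη (EuclideanSpace.single i 1)] with t ht
  exact congrFun (congrFun (transpose_eq_of_posDef (hP _ ht)) k) l

/-- Treats `Wg` and `Wy` together, with `c = σ⁴` and `B = S⁻²` or `B = S⁻¹`. -/
lemma trace_eq_zero_of_quadratic_argmin (hP : ∀ η ∈ Ω, (P η).PosDef) (θ₀ : Fin n → ℝ)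
    {B : Matrix (Fin n) (Fin n) ℝ} (hB : Bᵀ = B) {W : EuclideanSpace ℝ (Fin p) → ℝ} {c : ℝ}
    (hc : c ≠ 0) (hW : ∀ η, W η = c * (((P η)⁻¹ *ᵥ θ₀) ⬝ᵥ (B *ᵥ ((P η)⁻¹ *ᵥ θ₀)))
      - 2 * c * (B * (P η)⁻¹).trace)
    (hη : η ∈ argminSet W Ω ∩ interior Ω) (hD : HasPartialDeriv P D η i) :
    ((P η)⁻¹ * B * (P η)⁻¹ * (P η - vecMulVec θ₀ θ₀) * (P η)⁻¹ * D).trace = 0 := by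
  have hPη := hP η hη.1.1
  have hdet := isUnit_det_of_posDef hPη
  -- Symmetry of `D` is inherited from `P` near the interior point; it lets `T * D * T` cross the
  -- dot product below.
  have hDs := hD.transpose_eq hη.2 hP
  have hTs : ((P η)⁻¹)ᵀ = (P η)⁻¹ := transpose_eq_of_posDef hPη.inv
  set e : EuclideanSpace ℝ (Fin p) := EuclideanSpace.single i 1 with he
  have h0 : η + (0 : ℝ) • e = η := by simp
  have hT := hasDerivAt_matrix_inv (A := fun t : ℝ => P (η + t • e)) (x := 0) (D := D) hD
    (by rw [h0]; exact hdet.ne_zero)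
  simp only [h0] at hT
  set T := (P η)⁻¹ with hTdef
  have hy := hasDerivAt_mulVec hT θ₀
  have hBy := hasDerivAt_const_mulVec hy B
  have hder := ((hasDerivAt_dotProduct hy hBy).const_mul c).sub
    ((hasDerivAt_trace_mul hT B).const_mul (2 * c))
  have hzero := derivative_eq_zero_of_mem_argminSet (e := e) hη
    (by simp only [hW]; exact hder)
  simp only [h0, ← hTdef] at hzero
  have h1 : (T *ᵥ θ₀) ⬝ᵥ (B *ᵥ (-(T * D * T) *ᵥ θ₀))
      = (-(T * D * T) *ᵥ θ₀) ⬝ᵥ (B *ᵥ (T *ᵥ θ₀)) := by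
    rw [dotProduct_mulVec, ← mulVec_transpose, hB, dotProduct_comm]
  have h2 : (-(T * D * T) *ᵥ θ₀) ⬝ᵥ (B *ᵥ (T *ᵥ θ₀))
      = -(θ₀ ⬝ᵥ ((T * D * (T * B * T)) *ᵥ θ₀)) := by
    rw [neg_mulVec, neg_dotProduct, dotProduct_comm, dotProduct_mulVec, ← mulVec_transpose,
      transpose_mul, transpose_mul, hTs, hDs, dotProduct_comm, mulVec_mulVec, mulVec_mulVec]
    simp only [Matrix.mul_assoc]
  have h3 : (B * -(T * D * T)).trace = -(T * B * T * D).trace := by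
    rw [mul_neg, trace_neg, ← Matrix.mul_assoc, trace_mul_comm]
    simp only [Matrix.mul_assoc]
  rw [h1, h2, h3] at hzero
  have h4 : (T * B * T * (P η - vecMulVec θ₀ θ₀) * T * D).trace
      = (T * B * T * D).trace - θ₀ ⬝ᵥ ((T * D * (T * B * T)) *ᵥ θ₀) := by
    rw [Matrix.mul_assoc _ T D, mul_sub, sub_mul, trace_sub, trace_mul_vecMulVec_mul,
      Matrix.mul_assoc (T * B * T) (P η), ← Matrix.mul_assoc (P η) T D, hTdef,
      mul_nonsing_inv _ hdet, one_mul]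
  rw [h4]
  have h5 : 2 * c * ((T * B * T * D).trace - θ₀ ⬝ᵥ ((T * D * (T * B * T)) *ᵥ θ₀)) = 0 := by
    linarith
  exact (mul_eq_zero.1 h5).resolve_left (by simpa using hc)

lemma trace_eq_zero_of_WB_argmin (hP : ∀ η ∈ Ω, (P η).PosDef) (θ₀ : Fin n → ℝ)
    (hη : η ∈ argminSet (fun η => WB (P η) θ₀) Ω ∩ interior Ω) (hD : HasPartialDeriv P D η i) :
    ((P η)⁻¹ * (P η - vecMulVec θ₀ θ₀) * (P η)⁻¹ * D).trace = 0 := by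
  have hPη := hP η hη.1.1
  have hdet := isUnit_det_of_posDef hPη
  set e : EuclideanSpace ℝ (Fin p) := EuclideanSpace.single i 1 with he
  have h0 : η + (0 : ℝ) • e = η := by simp
  have hdet0 : (P (η + (0 : ℝ) • e)).det ≠ 0 := by rw [h0]; exact hdet.ne_zero
  have hT := hasDerivAt_matrix_inv (A := fun t : ℝ => P (η + t • e)) (x := 0) (D := D) hD hdet0
  have hlog := (hasDerivAt_matrix_det (A := fun t : ℝ => P (η + t • e)) (x := 0) (D := D) hD).log
    hdet0
  have hder := (hasDerivAt_dotProduct (fun k => hasDerivAt_const (0 : ℝ) (θ₀ k))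
    (hasDerivAt_mulVec hT θ₀)).add hlog
  have hzero := derivative_eq_zero_of_mem_argminSet (e := e) hη hder
  simp only [h0] at hzero
  have h1 : ((P η).adjugate * D).trace / (P η).det = ((P η)⁻¹ * D).trace := by
    rw [inv_def, Ring.inverse_eq_inv', smul_mul_assoc, trace_smul, smul_eq_mul, div_eq_inv_mul]
  have h2 : (fun _ : Fin n => (0 : ℝ)) ⬝ᵥ ((P η)⁻¹ *ᵥ θ₀) = 0 := zero_dotProduct _
  rw [h1, h2, neg_mulVec, dotProduct_neg] at hzero
  rw [Matrix.mul_assoc _ _ D, mul_sub, sub_mul, trace_sub, trace_mul_vecMulVec_mul,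
    nonsing_inv_mul _ hdet, one_mul]
  linarith

end Stationarity

/-! ### Equivalent forms of the limit criteria. -/

section LimitCriteria

variable {n : ℕ} {σ : ℝ} {S P : Matrix (Fin n) (Fin n) ℝ}

lemma dotProduct_congruence_mulVec (T B : Matrix (Fin n) (Fin n) ℝ) (θ : Fin n → ℝ) :
    θ ⬝ᵥ ((Tᵀ * B * T) *ᵥ θ) = (T *ᵥ θ) ⬝ᵥ (B *ᵥ (T *ᵥ θ)) := by
  rw [← mulVec_mulVec, ← mulVec_mulVec, dotProduct_mulVec θ, vecMul_transpose]

lemma Wg_eq (θ₀ : Fin n → ℝ) :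
    Wg σ P S θ₀ = σ ^ 4 * ((P⁻¹ *ᵥ θ₀) ⬝ᵥ ((S⁻¹ * S⁻¹) *ᵥ (P⁻¹ *ᵥ θ₀)))
      - 2 * σ ^ 4 * ((S⁻¹ * S⁻¹) * P⁻¹).trace := by
  rw [Wg, Matrix.mul_assoc P⁻¹ᵀ, dotProduct_congruence_mulVec, trace_mul_comm _ S⁻¹,
    Matrix.mul_assoc]

lemma Wy_eq (θ₀ : Fin n → ℝ) :
    Wy σ P S θ₀ = σ ^ 4 * ((P⁻¹ *ᵥ θ₀) ⬝ᵥ (S⁻¹ *ᵥ (P⁻¹ *ᵥ θ₀)))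
      - 2 * σ ^ 4 * (S⁻¹ * P⁻¹).trace := by
  rw [Wy, dotProduct_congruence_mulVec]

/-- The shape in which the limit of the rescaled criteria appears, with `S⁻¹` in the place of `(R /
N)⁻¹`. -/
lemma Wg_eq_sqNorm (hS : S.PosDef) (θ₀ : Fin n → ℝ) :
    Wg σ P S θ₀ = σ ^ 4 * sqNorm (S⁻¹ *ᵥ (P⁻¹ *ᵥ θ₀))
      - 2 * σ ^ 4 * (S⁻¹ * P⁻¹ * S⁻¹).trace := by
  rw [Wg_eq, sqNorm_mulVec, transpose_eq_of_posDef hS.inv, trace_mul_comm _ S⁻¹, Matrix.mul_assoc]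

lemma Wy_eq_gram (hS : S.PosDef) (θ₀ : Fin n → ℝ) :
    Wy σ P S θ₀ = σ ^ 4 * ((S⁻¹ *ᵥ (P⁻¹ *ᵥ θ₀)) ⬝ᵥ (S *ᵥ (S⁻¹ *ᵥ (P⁻¹ *ᵥ θ₀))))
      - 2 * σ ^ 4 * (S⁻¹ * P⁻¹).trace := by
  rw [Wy_eq, mulVec_mulVec _ S, mul_nonsing_inv _ (isUnit_det_of_posDef hS), one_mulVec,
    dotProduct_comm]

end LimitCriteria

/-! ### Rescaled limits, and consistency of least squares. -/

section Consistency

variable {E : Type*} [PseudoMetricSpace E] {Ω : Set E} {n : ℕ} {σ : ℝ}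
  {P : E → Matrix (Fin n) (Fin n) ℝ} {S : Matrix (Fin n) (Fin n) ℝ} {θ₀ : Fin n → ℝ}
  {Φ : (N : ℕ) → Matrix (Fin N) (Fin n) ℝ} {Y : (N : ℕ) → Fin N → ℝ}

lemma tendsto_inv_kernel (hPcont : ContinuousOn P Ω) (hPpos : ∀ η ∈ Ω, (P η).PosDef) {η : E}
    (hη : η ∈ Ω) : Tendsto (fun η' => (P η')⁻¹) (𝓝[Ω] η) (𝓝 (P η)⁻¹) :=
  tendsto_matrix_inv (hPcont η hη) (hPpos η hη).det_pos.ne'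

lemma tendsto_sqNorm {ι : Type*} {l : Filter ι} {m : ℕ} {f : ι → Fin m → ℝ} {x : Fin m → ℝ}
    (hf : Tendsto f l (𝓝 x)) : Tendsto (fun i => sqNorm (f i)) l (𝓝 (sqNorm x)) := by
  simp only [sqNorm_eq_dotProduct]
  exact tendsto_dotProduct hf hf

lemma continuousOn_Wg (hPcont : ContinuousOn P Ω) (hPpos : ∀ η ∈ Ω, (P η).PosDef) :
    ContinuousOn (fun η => Wg σ (P η) S θ₀) Ω := by
  intro η hη
  have hT := tendsto_inv_kernel hPcont hPpos hη
  have hy := tendsto_mulVec hT (tendsto_const_nhds (x := θ₀))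
  simp only [ContinuousWithinAt, Wg_eq]
  exact ((tendsto_dotProduct hy (tendsto_mulVec tendsto_const_nhds hy)).const_mul _).sub
    ((tendsto_matrix_trace (tendsto_const_nhds.mul hT)).const_mul _)

lemma continuousOn_Wy (hPcont : ContinuousOn P Ω) (hPpos : ∀ η ∈ Ω, (P η).PosDef) :
    ContinuousOn (fun η => Wy σ (P η) S θ₀) Ω := by
  intro η hη
  have hT := tendsto_inv_kernel hPcont hPpos hη
  have hy := tendsto_mulVec hT (tendsto_const_nhds (x := θ₀))
  simp only [ContinuousWithinAt, Wy_eq]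
  exact ((tendsto_dotProduct hy (tendsto_mulVec tendsto_const_nhds hy)).const_mul _).sub
    ((tendsto_matrix_trace (tendsto_const_nhds.mul hT)).const_mul _)

lemma continuousOn_WB (hPcont : ContinuousOn P Ω) (hPpos : ∀ η ∈ Ω, (P η).PosDef) :
    ContinuousOn (fun η => WB (P η) θ₀) Ω := by
  intro η hη
  exact (tendsto_dotProduct tendsto_const_nhds
    (tendsto_mulVec (tendsto_inv_kernel hPcont hPpos hη) tendsto_const_nhds)).add
    (tendsto_matrix_log_det (hPcont η hη) (hPpos η hη).det_pos.ne')

/-- The inverse of `R / N`. -/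
def scaledRinv {N : ℕ} (σ : ℝ) (Φ : Matrix (Fin N) (Fin n) ℝ) (P : Matrix (Fin n) (Fin n) ℝ) :
    Matrix (Fin n) (Fin n) ℝ := ((N : ℝ)⁻¹ • Rmat σ Φ P)⁻¹

lemma inv_inv_smul {c : ℝ} (hc : c ≠ 0) {A : Matrix (Fin n) (Fin n) ℝ} (hA : IsUnit A.det) :
    A⁻¹ = c⁻¹ • (c⁻¹ • A)⁻¹ := by
  refine inv_eq_left_inv ?_
  have h : IsUnit (c⁻¹ • A).det := by
    rw [det_smul]
    exact ((inv_ne_zero hc).isUnit.pow _).mul hA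
  rw [smul_mul_assoc, ← mul_smul_comm, nonsing_inv_mul _ h]

lemma Rmat_inv_eq_smul {N : ℕ} (hN : 0 < N) (hσ : 0 < σ) {Φ : Matrix (Fin N) (Fin n) ℝ}
    {P : Matrix (Fin n) (Fin n) ℝ} (hP : P.PosDef) :
    (Rmat σ Φ P)⁻¹ = (N : ℝ)⁻¹ • scaledRinv σ Φ P :=
  inv_inv_smul (by positivity) (isUnit_det_of_posDef (posDef_Rmat hσ hP))

lemma log_det_Rmat {N : ℕ} (hN : 0 < N) (hσ : 0 < σ) {Φ : Matrix (Fin N) (Fin n) ℝ}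
    {P : Matrix (Fin n) (Fin n) ℝ} (hP : P.PosDef) :
    Real.log (Rmat σ Φ P).det
      = Real.log ((N : ℝ)⁻¹ • Rmat σ Φ P).det - Real.log ((N : ℝ)⁻¹ ^ n) := by
  have hR := (posDef_Rmat (Φ := Φ) hσ hP).det_pos.ne'
  have hN' : (N : ℝ) ≠ 0 := by positivity
  rw [det_smul, Fintype.card_fin, Real.log_mul (by positivity) hR]
  ring

lemma tendsto_natCast_inv_fst {E : Type*} {l : Filter E} :
    Tendsto (fun z : ℕ × E => (z.1 : ℝ)⁻¹) (atTop ×ˢ l) (𝓝 0) :=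
  (tendsto_inv_atTop_nhds_zero_nat (𝕜 := ℝ)).comp tendsto_fst

/-- The regularization `σ² P⁻¹ / N` vanishes jointly in `N` and the parameter, as `P⁻¹` converges
along `𝓝[Ω] η`. -/
lemma tendsto_scaled_Rmat (hPcont : ContinuousOn P Ω) (hPpos : ∀ η ∈ Ω, (P η).PosDef)
    (hlim : Tendsto (fun N : ℕ => (N : ℝ)⁻¹ • ((Φ N)ᵀ * Φ N)) atTop (𝓝 S)) {η : E} (hη : η ∈ Ω) :
    Tendsto (fun z : ℕ × E => (z.1 : ℝ)⁻¹ • Rmat σ (Φ z.1) (P z.2)) (atTop ×ˢ 𝓝[Ω] η) (𝓝 S) := by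
  have h1 := ((tendsto_inv_kernel hPcont hPpos hη).comp
    (tendsto_snd (f := (atTop : Filter ℕ)))).const_smul (σ ^ 2)
  have h2 := (hlim.comp (tendsto_fst (g := 𝓝[Ω] η))).add (tendsto_natCast_inv_fst.smul h1)
  rw [zero_smul, add_zero] at h2
  exact h2.congr fun z => (smul_add _ _ _).symm

lemma tendsto_scaledRinv (hPcont : ContinuousOn P Ω) (hPpos : ∀ η ∈ Ω, (P η).PosDef)
    (hS : S.PosDef) (hlim : Tendsto (fun N : ℕ => (N : ℝ)⁻¹ • ((Φ N)ᵀ * Φ N)) atTop (𝓝 S))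
    {η : E} (hη : η ∈ Ω) :
    Tendsto (fun z : ℕ × E => scaledRinv σ (Φ z.1) (P z.2)) (atTop ×ˢ 𝓝[Ω] η) (𝓝 S⁻¹) :=
  tendsto_matrix_inv (tendsto_scaled_Rmat hPcont hPpos hlim hη) hS.det_pos.ne'

lemma eventually_isUnit_gram (hS : S.PosDef)
    (hlim : Tendsto (fun N : ℕ => (N : ℝ)⁻¹ • ((Φ N)ᵀ * Φ N)) atTop (𝓝 S)) :
    ∀ᶠ N : ℕ in atTop, 0 < N ∧ IsUnit ((Φ N)ᵀ * Φ N).det := by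
  have h := (((continuous_id.matrix_det).tendsto S).comp hlim).eventually_ne hS.det_pos.ne'
  filter_upwards [h, eventually_gt_atTop 0] with N h1 h2
  refine ⟨h2, IsUnit.mk0 _ fun h3 => h1 ?_⟩
  simp [h3]

/-- A continuous positive definite kernel on a nonempty compact set, with regressors whose
normalized Gram matrices converge to a positive definite matrix. -/
structure IsRegularDesign (Ω : Set E) (P : E → Matrix (Fin n) (Fin n) ℝ) (σ : ℝ)
    (S : Matrix (Fin n) (Fin n) ℝ) (Φ : (N : ℕ) → Matrix (Fin N) (Fin n) ℝ) : Prop where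
  isCompact : IsCompact Ω
  nonempty : Ω.Nonempty
  sigma_pos : 0 < σ
  continuousOn : ContinuousOn P Ω
  posDef : ∀ η ∈ Ω, (P η).PosDef
  limit_posDef : S.PosDef
  tendsto_gram : Tendsto (fun N : ℕ => (N : ℝ)⁻¹ • ((Φ N)ᵀ * Φ N)) atTop (𝓝 S)

namespace IsRegularDesign

lemma tendsto_inv (h : IsRegularDesign Ω P σ S Φ) {η : E} (hη : η ∈ Ω) :
    Tendsto (fun z : ℕ × E => (P z.2)⁻¹) (atTop ×ˢ 𝓝[Ω] η) (𝓝 (P η)⁻¹) :=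
  (tendsto_inv_kernel h.continuousOn h.posDef hη).comp tendsto_snd

lemma tendsto_scaledRinv (h : IsRegularDesign Ω P σ S Φ) {η : E} (hη : η ∈ Ω) :
    Tendsto (fun z : ℕ × E => scaledRinv σ (Φ z.1) (P z.2)) (atTop ×ˢ 𝓝[Ω] η) (𝓝 S⁻¹) :=
  KernelReg.tendsto_scaledRinv h.continuousOn h.posDef h.limit_posDef h.tendsto_gram hη

lemma tendsto_gram_inv (h : IsRegularDesign Ω P σ S Φ) :
    Tendsto (fun N : ℕ => ((N : ℝ)⁻¹ • ((Φ N)ᵀ * Φ N))⁻¹) atTop (𝓝 S⁻¹) :=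
  tendsto_matrix_inv h.tendsto_gram h.limit_posDef.det_pos.ne'

lemma tendsto_scaledRinv_mulVec (h : IsRegularDesign Ω P σ S Φ) {η : E} (hη : η ∈ Ω)
    {θ : ℕ → Fin n → ℝ} (hθ : Tendsto θ atTop (𝓝 θ₀)) :
    Tendsto (fun z : ℕ × E => scaledRinv σ (Φ z.1) (P z.2) *ᵥ ((P z.2)⁻¹ *ᵥ θ z.1))
      (atTop ×ˢ 𝓝[Ω] η) (𝓝 (S⁻¹ *ᵥ ((P η)⁻¹ *ᵥ θ₀))) :=
  tendsto_mulVec (h.tendsto_scaledRinv hη) (tendsto_mulVec (h.tendsto_inv hη)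
    (hθ.comp tendsto_fst))

lemma eventually_isUnit (h : IsRegularDesign Ω P σ S Φ) :
    ∀ᶠ N : ℕ in atTop, 0 < N ∧ IsUnit ((Φ N)ᵀ * Φ N).det :=
  eventually_isUnit_gram h.limit_posDef h.tendsto_gram

lemma eventually_inv_pow_pos (k : ℕ) : ∀ᶠ N : ℕ in atTop, 0 < ((N : ℝ)⁻¹) ^ k := by
  filter_upwards [eventually_gt_atTop 0] with N hN
  positivity

lemma minimizersTendsto_FSg (h : IsRegularDesign Ω P σ S Φ)
    (hθ : Tendsto (fun N => thetaLS (Φ N) (Y N)) atTop (𝓝 θ₀)) :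
    MinimizersTendsto (fun N η => FSg σ (Φ N) (Y N) (P η)) Ω
      (argminSet (fun η => Wg σ (P η) S θ₀) Ω) := by
  refine minimizersTendsto_of_tendsto h.isCompact h.nonempty
    (F := fun N η => σ ^ 4 * sqNorm (scaledRinv σ (Φ N) (P η) *ᵥ ((P η)⁻¹ *ᵥ thetaLS (Φ N) (Y N)))
      - 2 * σ ^ 4 * (scaledRinv σ (Φ N) (P η) * (P η)⁻¹
        * ((N : ℝ)⁻¹ • ((Φ N)ᵀ * Φ N))⁻¹).trace)
    (fun N => σ ^ 2 * (((Φ N)ᵀ * Φ N)⁻¹).trace) (fun N => ((N : ℝ)⁻¹) ^ 2)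
    (eventually_inv_pow_pos 2) ?_ (continuousOn_Wg h.continuousOn h.posDef) ?_
  · filter_upwards [h.eventually_isUnit] with N hN η hη
    rw [FSg_eq h.sigma_pos (h.posDef η hη) hN.2,
      Rmat_inv_eq_smul hN.1 h.sigma_pos (h.posDef η hη),
      inv_inv_smul (c := (N : ℝ)) (by exact_mod_cast hN.1.ne') hN.2]
    simp only [smul_mulVec, sqNorm_smul, smul_mul_assoc, mul_smul_comm, trace_smul, smul_eq_mul]
    ring
  · intro η hη
    rw [Wg_eq_sqNorm h.limit_posDef]
    exact ((tendsto_sqNorm (h.tendsto_scaledRinv_mulVec hη hθ)).const_mul _).sub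
      ((tendsto_matrix_trace (((h.tendsto_scaledRinv hη).mul (h.tendsto_inv hη)).mul
        (h.tendsto_gram_inv.comp tendsto_fst))).const_mul _)

lemma minimizersTendsto_FSy (h : IsRegularDesign Ω P σ S Φ)
    (hθ : Tendsto (fun N => thetaLS (Φ N) (Y N)) atTop (𝓝 θ₀)) :
    MinimizersTendsto (fun N η => FSy σ (Φ N) (Y N) (P η)) Ω
      (argminSet (fun η => Wy σ (P η) S θ₀) Ω) := by
  refine minimizersTendsto_of_tendsto h.isCompact h.nonempty
    (F := fun N η =>
      σ ^ 4 * ((scaledRinv σ (Φ N) (P η) *ᵥ ((P η)⁻¹ *ᵥ thetaLS (Φ N) (Y N)))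
        ⬝ᵥ (((N : ℝ)⁻¹ • ((Φ N)ᵀ * Φ N))
          *ᵥ (scaledRinv σ (Φ N) (P η) *ᵥ ((P η)⁻¹ *ᵥ thetaLS (Φ N) (Y N)))))
      - 2 * σ ^ 4 * (scaledRinv σ (Φ N) (P η) * (P η)⁻¹).trace)
    (fun N => sqNorm (Y N - Φ N *ᵥ thetaLS (Φ N) (Y N)) + 2 * σ ^ 2 * n)
    (fun N => ((N : ℝ)⁻¹) ^ 1)
    (eventually_inv_pow_pos 1) ?_ (continuousOn_Wy h.continuousOn h.posDef) ?_
  · filter_upwards [h.eventually_isUnit] with N hN η hη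
    rw [FSy_eq h.sigma_pos (h.posDef η hη) hN.2,
      Rmat_inv_eq_smul hN.1 h.sigma_pos (h.posDef η hη)]
    simp only [smul_mulVec, mulVec_smul, smul_dotProduct, dotProduct_smul, smul_mul_assoc,
      trace_smul, smul_eq_mul]
    ring
  · intro η hη
    rw [Wy_eq_gram h.limit_posDef]
    have hx := h.tendsto_scaledRinv_mulVec hη hθ
    exact ((tendsto_dotProduct hx (tendsto_mulVec (h.tendsto_gram.comp tendsto_fst) hx)).const_mul
      _).sub ((tendsto_matrix_trace ((h.tendsto_scaledRinv hη).mul (h.tendsto_inv hη))).const_mul _)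

lemma tendsto_bayes (h : IsRegularDesign Ω P σ S Φ) {η : E} (hη : η ∈ Ω)
    {θ : ℕ → Fin n → ℝ} (hθ : Tendsto θ atTop (𝓝 θ₀)) :
    Tendsto (fun z : ℕ × E => θ z.1 ⬝ᵥ ((P z.2)⁻¹ *ᵥ θ z.1)
        - σ ^ 2 * (z.1 : ℝ)⁻¹
          * (θ z.1 ⬝ᵥ (((P z.2)⁻¹ * scaledRinv σ (Φ z.1) (P z.2) * (P z.2)⁻¹) *ᵥ θ z.1))
        + Real.log (P z.2).det + Real.log ((z.1 : ℝ)⁻¹ • Rmat σ (Φ z.1) (P z.2)).det)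
      (atTop ×ˢ 𝓝[Ω] η) (𝓝 (WB (P η) θ₀ + Real.log S.det)) := by
  have hT := h.tendsto_inv hη
  have hθ' := hθ.comp (tendsto_fst (g := 𝓝[Ω] η))
  have h1 := tendsto_dotProduct hθ' (tendsto_mulVec hT hθ')
  have h2 := ((tendsto_natCast_inv_fst (l := 𝓝[Ω] η)).const_mul (σ ^ 2)).mul
    (tendsto_dotProduct hθ' (tendsto_mulVec ((hT.mul (h.tendsto_scaledRinv hη)).mul hT) hθ'))
  have h3 := (tendsto_matrix_log_det (h.continuousOn η hη) (h.posDef η hη).det_pos.ne').comp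
    (tendsto_snd (f := (atTop : Filter ℕ)))
  have h4 := tendsto_matrix_log_det (tendsto_scaled_Rmat (σ := σ) h.continuousOn h.posDef
    h.tendsto_gram hη) h.limit_posDef.det_pos.ne'
  have h5 := ((h1.sub h2).add h3).add h4
  rw [mul_zero, zero_mul, sub_zero] at h5
  exact h5

lemma minimizersTendsto_FEB (h : IsRegularDesign Ω P σ S Φ)
    (hθ : Tendsto (fun N => thetaLS (Φ N) (Y N)) atTop (𝓝 θ₀)) :
    MinimizersTendsto (fun N η => FEB σ (Φ N) (Y N) (P η)) Ω
      (argminSet (fun η => WB (P η) θ₀) Ω) := by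
  refine minimizersTendsto_of_tendsto h.isCompact h.nonempty
    (F := fun N η => (thetaLS (Φ N) (Y N) ⬝ᵥ ((P η)⁻¹ *ᵥ thetaLS (Φ N) (Y N))
        - σ ^ 2 * (N : ℝ)⁻¹ * (thetaLS (Φ N) (Y N)
          ⬝ᵥ (((P η)⁻¹ * scaledRinv σ (Φ N) (P η) * (P η)⁻¹) *ᵥ thetaLS (Φ N) (Y N)))
        + Real.log (P η).det + Real.log ((N : ℝ)⁻¹ • Rmat σ (Φ N) (P η)).det)
      - Real.log S.det)
    (fun N => (σ ^ 2)⁻¹ * (Y N ⬝ᵥ Y N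
        - thetaLS (Φ N) (Y N) ⬝ᵥ (((Φ N)ᵀ * Φ N) *ᵥ thetaLS (Φ N) (Y N)))
      + Real.log ((σ ^ 2) ^ N * ((σ ^ 2)⁻¹) ^ n) - Real.log ((N : ℝ)⁻¹ ^ n) + Real.log S.det)
    -- No rescaling here: the `η`-dependence has order one, and the growth of `log det R` goes into
    -- the additive constant.
    (fun N => ((N : ℝ)⁻¹) ^ 0)
    (eventually_inv_pow_pos 0) ?_ (continuousOn_WB h.continuousOn h.posDef) ?_
  · filter_upwards [h.eventually_isUnit] with N hN η hη
    rw [FEB_eq h.sigma_pos (h.posDef η hη) hN.2, log_det_Rmat hN.1 h.sigma_pos (h.posDef η hη),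
      Rmat_inv_eq_smul hN.1 h.sigma_pos (h.posDef η hη)]
    simp only [smul_mulVec, dotProduct_smul, smul_mul_assoc, mul_smul_comm, smul_eq_mul]
    ring
  · intro η hη
    simpa using (h.tendsto_bayes hη hθ).sub_const (Real.log S.det)

section Oracle

variable {α : Type*} [MeasurableSpace α] {μ : Measure α} [IsProbabilityMeasure μ]
  {v : ℕ+ → α → ℝ}

lemma minimizersTendsto_MSEg (h : IsRegularDesign Ω P σ S Φ) (hv : IsWhiteNoise μ v σ)
    (θ₀ : Fin n → ℝ) :
    MinimizersTendsto (fun N η => MSEg μ v σ θ₀ (Φ N) (P η)) Ω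
      (argminSet (fun η => Wg σ (P η) S θ₀) Ω) := by
  refine minimizersTendsto_of_tendsto h.isCompact h.nonempty
    (F := fun N η => σ ^ 4 * sqNorm (scaledRinv σ (Φ N) (P η) *ᵥ ((P η)⁻¹ *ᵥ θ₀))
      - σ ^ 4 * (scaledRinv σ (Φ N) (P η) * (P η)⁻¹ * ((N : ℝ)⁻¹ • ((Φ N)ᵀ * Φ N))⁻¹).trace
      - σ ^ 4 * (scaledRinv σ (Φ N) (P η) * (P η)⁻¹ * scaledRinv σ (Φ N) (P η)).trace)
    (fun N => σ ^ 2 * (((Φ N)ᵀ * Φ N)⁻¹).trace) (fun N => ((N : ℝ)⁻¹) ^ 2)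
    (eventually_inv_pow_pos 2) ?_ (continuousOn_Wg h.continuousOn h.posDef) ?_
  · filter_upwards [h.eventually_isUnit] with N hN η hη
    rw [MSEg_eq hv h.sigma_pos (h.posDef η hη) hN.2,
      Rmat_inv_eq_smul hN.1 h.sigma_pos (h.posDef η hη),
      inv_inv_smul (c := (N : ℝ)) (by exact_mod_cast hN.1.ne') hN.2]
    simp only [smul_mulVec, sqNorm_smul, smul_mul_assoc, mul_smul_comm, trace_smul, smul_eq_mul]
    ring
  · intro η hη
    have hKT := (h.tendsto_scaledRinv hη).mul (h.tendsto_inv hη)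
    have hlim := (((tendsto_sqNorm (h.tendsto_scaledRinv_mulVec hη
      (tendsto_const_nhds (x := θ₀)))).const_mul (σ ^ 4)).sub
      ((tendsto_matrix_trace (hKT.mul (h.tendsto_gram_inv.comp tendsto_fst))).const_mul
        (σ ^ 4))).sub
      ((tendsto_matrix_trace (hKT.mul (h.tendsto_scaledRinv hη))).const_mul (σ ^ 4))
    -- Two different traces in the criterion share one limit, which accounts for the factor `2` in
    -- `Wg`.
    rw [Wg_eq_sqNorm h.limit_posDef, show ∀ a b : ℝ, a - 2 * σ ^ 4 * b
      = a - σ ^ 4 * b - σ ^ 4 * b by intros; ring]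
    exact hlim

lemma minimizersTendsto_MSEy (h : IsRegularDesign Ω P σ S Φ) (hv : IsWhiteNoise μ v σ)
    (θ₀ : Fin n → ℝ) :
    MinimizersTendsto (fun N η => MSEy μ v σ θ₀ (Φ N) (P η)) Ω
      (argminSet (fun η => Wy σ (P η) S θ₀) Ω) := by
  refine minimizersTendsto_of_tendsto h.isCompact h.nonempty
    (F := fun N η =>
      σ ^ 4 * ((scaledRinv σ (Φ N) (P η) *ᵥ ((P η)⁻¹ *ᵥ θ₀))
        ⬝ᵥ (((N : ℝ)⁻¹ • ((Φ N)ᵀ * Φ N)) *ᵥ (scaledRinv σ (Φ N) (P η) *ᵥ ((P η)⁻¹ *ᵥ θ₀))))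
      - 2 * σ ^ 4 * (scaledRinv σ (Φ N) (P η) * (P η)⁻¹).trace
      + σ ^ 6 * (N : ℝ)⁻¹ * (scaledRinv σ (Φ N) (P η) * (P η)⁻¹
        * (scaledRinv σ (Φ N) (P η) * (P η)⁻¹)).trace)
    (fun N => σ ^ 2 * n + σ ^ 2 * N) (fun N => ((N : ℝ)⁻¹) ^ 1)
    (eventually_inv_pow_pos 1) ?_ (continuousOn_Wy h.continuousOn h.posDef) ?_
  · filter_upwards [h.eventually_isUnit] with N hN η hη
    rw [MSEy_eq hv h.sigma_pos (h.posDef η hη),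
      Rmat_inv_eq_smul hN.1 h.sigma_pos (h.posDef η hη)]
    simp only [smul_mulVec, mulVec_smul, smul_dotProduct, dotProduct_smul, smul_mul_assoc,
      mul_smul_comm, trace_smul, smul_eq_mul]
    ring
  · intro η hη
    have hKT := (h.tendsto_scaledRinv hη).mul (h.tendsto_inv hη)
    have hx := h.tendsto_scaledRinv_mulVec hη (tendsto_const_nhds (x := θ₀))
    have hlim := (((tendsto_dotProduct hx (tendsto_mulVec
      (h.tendsto_gram.comp tendsto_fst) hx)).const_mul (σ ^ 4)).sub
      ((tendsto_matrix_trace hKT).const_mul (2 * σ ^ 4))).add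
      (((tendsto_natCast_inv_fst (l := 𝓝[Ω] η)).const_mul (σ ^ 6)).mul
        (tendsto_matrix_trace (hKT.mul hKT)))
    rw [mul_zero, zero_mul, add_zero, ← Wy_eq_gram h.limit_posDef] at hlim
    exact hlim

lemma minimizersTendsto_EEB (h : IsRegularDesign Ω P σ S Φ) (hv : IsWhiteNoise μ v σ)
    (θ₀ : Fin n → ℝ) :
    MinimizersTendsto (fun N η => EEB μ v σ θ₀ (Φ N) (P η)) Ω
      (argminSet (fun η => WB (P η) θ₀) Ω) := by
  refine minimizersTendsto_of_tendsto h.isCompact h.nonempty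
    (F := fun N η => (θ₀ ⬝ᵥ ((P η)⁻¹ *ᵥ θ₀)
        - σ ^ 2 * (N : ℝ)⁻¹
          * (θ₀ ⬝ᵥ (((P η)⁻¹ * scaledRinv σ (Φ N) (P η) * (P η)⁻¹) *ᵥ θ₀))
        + Real.log (P η).det + Real.log ((N : ℝ)⁻¹ • Rmat σ (Φ N) (P η)).det)
      + σ ^ 2 * (N : ℝ)⁻¹ * (scaledRinv σ (Φ N) (P η) * (P η)⁻¹).trace - Real.log S.det)
    (fun N => (σ ^ 2)⁻¹ * ((Φ N *ᵥ θ₀) ⬝ᵥ (Φ N *ᵥ θ₀) - θ₀ ⬝ᵥ (((Φ N)ᵀ * Φ N) *ᵥ θ₀))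
      + Real.log ((σ ^ 2) ^ N * ((σ ^ 2)⁻¹) ^ n) + (N - n) - Real.log ((N : ℝ)⁻¹ ^ n)
      + Real.log S.det)
    (fun N => ((N : ℝ)⁻¹) ^ 0)
    (eventually_inv_pow_pos 0) ?_ (continuousOn_WB h.continuousOn h.posDef) ?_
  · filter_upwards [h.eventually_isUnit] with N hN η hη
    rw [EEB_eq hv h.sigma_pos (h.posDef η hη) hN.2,
      log_det_Rmat hN.1 h.sigma_pos (h.posDef η hη),
      Rmat_inv_eq_smul hN.1 h.sigma_pos (h.posDef η hη)]
    simp only [smul_mulVec, dotProduct_smul, smul_mul_assoc, mul_smul_comm, trace_smul,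
      smul_eq_mul]
    ring
  · intro η hη
    have hKT := (h.tendsto_scaledRinv hη).mul (h.tendsto_inv hη)
    have hlim := ((h.tendsto_bayes hη (tendsto_const_nhds (x := θ₀))).add
      (((tendsto_natCast_inv_fst (l := 𝓝[Ω] η)).const_mul (σ ^ 2)).mul
        (tendsto_matrix_trace hKT))).sub_const (Real.log S.det)
    rw [mul_zero, zero_mul, add_zero, add_sub_cancel_right] at hlim
    exact hlim

end Oracle

end IsRegularDesign

lemma thetaLS_output {N : ℕ} {Φ : Matrix (Fin N) (Fin n) ℝ} (hN : 0 < N)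
    (hG : IsUnit (Φᵀ * Φ).det) (θ₀ : Fin n → ℝ) (V : Fin N → ℝ) :
    thetaLS Φ (output Φ θ₀ V)
      = θ₀ + ((N : ℝ)⁻¹ • (Φᵀ * Φ))⁻¹ *ᵥ ((N : ℝ)⁻¹ • (Φᵀ *ᵥ V)) := by
  have h := thetaLS_mulVec hG θ₀
  rw [thetaLS] at h
  rw [thetaLS, output, mulVec_add, h, inv_inv_smul (c := (N : ℝ)) (by exact_mod_cast hN.ne') hG,
    Matrix.smul_mul, smul_mulVec, mulVec_smul, mulVec_mulVec]

/-- The least squares estimate is strongly consistent. -/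
lemma ae_tendsto_thetaLS {α : Type*} [MeasurableSpace α] {μ : Measure α} [IsProbabilityMeasure μ]
    (θ₀ : Fin n → ℝ) {u : ℤ → α → ℝ} (hu : ∀ t, Measurable (u t)) {v : ℕ+ → α → ℝ}
    (hv : IsWhiteNoise μ v σ) (huv : IndepFun (fun ω t => u t ω) (fun ω t => v t ω) μ)
    (hS : S.PosDef)
    (hlim : ∀ᵐ ω ∂μ, Tendsto (fun N : ℕ => (N : ℝ)⁻¹ • ((regressor n N fun t => u t ω)ᵀ
      * regressor n N fun t => u t ω)) atTop (𝓝 S)) :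
    ∀ᵐ ω ∂μ, Tendsto (fun N => thetaLS (regressor n N fun t => u t ω)
      (output (regressor n N fun t => u t ω) θ₀ (noiseVec N fun t => v t ω))) atTop (𝓝 θ₀) := by
  have hw : IsWhite μ (fun t : ℕ => v (Nat.succPNat t)) (σ ^ 2) :=
    hv.isWhite.comp_injective Nat.succPNat_injective
  have hcol : ∀ᵐ ω ∂μ, ∀ k : Fin n, Tendsto (fun N : ℕ => (N : ℝ)⁻¹ *
      ∑ t ∈ Finset.range N, u ((t + 1 : ℤ) - ((k : ℕ) + 1 : ℤ)) ω * v (Nat.succPNat t) ω)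
      atTop (𝓝 0) := by
    rw [ae_all_iff]
    intro k
    refine hw.ae_tendsto_average_of_indepFun (fun t => hu _) ?_ ?_
    · exact huv.comp (φ := fun x : ℤ → ℝ => fun t : ℕ => x ((t + 1 : ℤ) - ((k : ℕ) + 1 : ℤ)))
        (ψ := fun x : ℕ+ → ℝ => fun t : ℕ => x (Nat.succPNat t))
        (measurable_pi_lambda _ fun t => measurable_pi_apply _)
        (measurable_pi_lambda _ fun t => measurable_pi_apply _)
    · filter_upwards [hlim] with ω hω
      -- The `k`-th diagonal entry of the normalized Gram matrix is the mean square of regressor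
      -- column `k`; being convergent, it is bounded, as the strong law requires.
      obtain ⟨c, hc⟩ := (tendsto_pi_nhds.1 (tendsto_pi_nhds.1 hω k) k).bddAbove_range
      refine ⟨⌈c⌉₊, fun N => ?_⟩
      rcases Nat.eq_zero_or_pos N with rfl | hN
      · simp
      have h1 := (hc ⟨N, rfl⟩).trans (Nat.le_ceil c)
      have h2 : ((regressor n N fun t => u t ω)ᵀ * regressor n N fun t => u t ω) k k
          = ∑ t ∈ Finset.range N, u ((t + 1 : ℤ) - ((k : ℕ) + 1 : ℤ)) ω ^ 2 := by
        rw [Finset.sum_range]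
        simp [Matrix.mul_apply, regressor, sq]
      have h3 : (N : ℝ)⁻¹ * ∑ t ∈ Finset.range N, u ((t + 1 : ℤ) - ((k : ℕ) + 1 : ℤ)) ω ^ 2
          ≤ ⌈c⌉₊ := by
        rw [← h2]
        exact h1
      rwa [inv_mul_le_iff₀ (by positivity), mul_comm] at h3
  filter_upwards [hlim, hcol] with ω h1 h2
  have h3 : Tendsto (fun N : ℕ => (N : ℝ)⁻¹ • ((regressor n N fun t => u t ω)ᵀ
      *ᵥ noiseVec N fun t => v t ω)) atTop (𝓝 0) := by
    refine tendsto_pi_nhds.2 fun k => (h2 k).congr fun N => ?_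
    rw [Finset.sum_range]
    rfl
  have h4 := (tendsto_const_nhds (x := θ₀)).add
    (tendsto_mulVec (tendsto_matrix_inv h1 hS.det_pos.ne') h3)
  rw [mulVec_zero, add_zero] at h4
  refine h4.congr' ?_
  filter_upwards [eventually_isUnit_gram hS h1] with N hN
  exact (thetaLS_output hN.1 hN.2 _ _).symm

end Consistency

end KernelReg

end

/-! ### Assembly of the main theorem. -/

theorem mainTheorem1
    {α : Type*} [MeasurableSpace α] (μ : Measure α) [IsProbabilityMeasure μ]
    (n p : ℕ) (θ₀ : Fin n → ℝ) (σ : ℝ) (hσ : 0 < σ)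
    (u : ℤ → α → ℝ) (hu : ∀ t, Measurable (u t))
    (v : ℕ+ → α → ℝ) (hv : KernelReg.IsWhiteNoise μ v σ)
    (huv : IndepFun (fun ω t => u t ω) (fun ω t => v t ω) μ)
    (Ω : Set (EuclideanSpace ℝ (Fin p))) (hΩ : IsCompact Ω) (hΩne : Ω.Nonempty)
    (P : EuclideanSpace ℝ (Fin p) → Matrix (Fin n) (Fin n) ℝ)
    (hPcont : ContinuousOn P Ω) (hPpos : ∀ η ∈ Ω, (P η).PosDef)
    (S : Matrix (Fin n) (Fin n) ℝ) (hS : S.PosDef)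
    (Φ : (N : ℕ) → α → Matrix (Fin N) (Fin n) ℝ)
    (hΦ : Φ = fun N ω => KernelReg.regressor n N fun t => u t ω)
    (Y : (N : ℕ) → α → Fin N → ℝ)
    (hY : Y = fun N ω => KernelReg.output (Φ N ω) θ₀ (KernelReg.noiseVec N fun t => v t ω))
    (hlim : ∀ᵐ ω ∂μ,
      Tendsto (fun N : ℕ => (N : ℝ)⁻¹ • ((Φ N ω)ᵀ * Φ N ω)) atTop (𝓝 S))
    (ηg ηy ηB : Set (EuclideanSpace ℝ (Fin p)))
    (hηg : ηg = KernelReg.argminSet (fun η => KernelReg.Wg σ (P η) S θ₀) Ω)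
    (hηy : ηy = KernelReg.argminSet (fun η => KernelReg.Wy σ (P η) S θ₀) Ω)
    (hηB : ηB = KernelReg.argminSet (fun η => KernelReg.WB (P η) θ₀) Ω) :
    (∀ᵐ ω ∂μ,
      KernelReg.MinimizersTendsto
        (fun N η => KernelReg.MSEg μ v σ θ₀ (Φ N ω) (P η)) Ω ηg ∧
      KernelReg.MinimizersTendsto
        (fun N η => KernelReg.FSg σ (Φ N ω) (Y N ω) (P η)) Ω ηg ∧
      KernelReg.MinimizersTendsto
        (fun N η => KernelReg.MSEy μ v σ θ₀ (Φ N ω) (P η)) Ω ηy ∧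
      KernelReg.MinimizersTendsto
        (fun N η => KernelReg.FSy σ (Φ N ω) (Y N ω) (P η)) Ω ηy ∧
      KernelReg.MinimizersTendsto
        (fun N η => KernelReg.EEB μ v σ θ₀ (Φ N ω) (P η)) Ω ηB ∧
      KernelReg.MinimizersTendsto
        (fun N η => KernelReg.FEB σ (Φ N ω) (Y N ω) (P η)) Ω ηB) ∧
    (∀ η ∈ ηg ∩ interior Ω, ∀ (i : Fin p) (D : Matrix (Fin n) (Fin n) ℝ),
      KernelReg.HasPartialDeriv P D η i →
      ((P η)⁻¹ * (S⁻¹ * S⁻¹) * (P η)⁻¹ * (P η - vecMulVec θ₀ θ₀) * (P η)⁻¹ * D).trace = 0) ∧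
    (∀ η ∈ ηy ∩ interior Ω, ∀ (i : Fin p) (D : Matrix (Fin n) (Fin n) ℝ),
      KernelReg.HasPartialDeriv P D η i →
      ((P η)⁻¹ * S⁻¹ * (P η)⁻¹ * (P η - vecMulVec θ₀ θ₀) * (P η)⁻¹ * D).trace = 0) ∧
    (∀ η ∈ ηB ∩ interior Ω, ∀ (i : Fin p) (D : Matrix (Fin n) (Fin n) ℝ),
      KernelReg.HasPartialDeriv P D η i →
      ((P η)⁻¹ * (P η - vecMulVec θ₀ θ₀) * (P η)⁻¹ * D).trace = 0) := by
  subst hΦ hY hηg hηy hηB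
  refine ⟨?_, ?_, ?_, ?_⟩
  · filter_upwards [hlim, KernelReg.ae_tendsto_thetaLS θ₀ hu hv huv hS hlim] with ω h1 hθ
    have h : KernelReg.IsRegularDesign Ω P σ S fun N => KernelReg.regressor n N fun t => u t ω :=
      ⟨hΩ, hΩne, hσ, hPcont, hPpos, hS, h1⟩
    exact ⟨h.minimizersTendsto_MSEg hv θ₀, h.minimizersTendsto_FSg hθ,
      h.minimizersTendsto_MSEy hv θ₀, h.minimizersTendsto_FSy hθ,
      h.minimizersTendsto_EEB hv θ₀, h.minimizersTendsto_FEB hθ⟩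
  · intro η hη i D hD
    have hSs : (S⁻¹)ᵀ = S⁻¹ := KernelReg.transpose_eq_of_posDef hS.inv
    exact KernelReg.trace_eq_zero_of_quadratic_argmin hPpos θ₀
      (by rw [transpose_mul, hSs]) (pow_ne_zero 4 hσ.ne') (fun η => KernelReg.Wg_eq θ₀) hη hD
  · intro η hη i D hD
    exact KernelReg.trace_eq_zero_of_quadratic_argmin hPpos θ₀
      (KernelReg.transpose_eq_of_posDef hS.inv) (pow_ne_zero 4 hσ.ne')
      (fun η => KernelReg.Wy_eq θ₀) hη hD
  · intro η hη i D hD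
    exact KernelReg.trace_eq_zero_of_WB_argmin hPpos θ₀ hη hD
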